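/- Let $G=(G(x))_{x\in\mathbb R}$ be a centered stationary Gaussian random field on $\mathbb R$ with almost surely continuous realizations and covariance $\mathbb E[G(x)G(y)]=\mathcal C(x-y)$, and assume that for some $\beta>1$ and some constant $A$ we have $|\mathcal C(x)|\le A(1+|x|)^{-\beta}$ for all $x\in\mathbb R$. Assume that $G\not\equiv 0$ (that is, $G$ does not vanish identically almost surely), and set $a(x):=\exp(G(x))$. Then almost surely, for all $\varepsilon>0$ and $f\in C^1([0,1])$, the problem $$\big(a(\tfrac x\varepsilon)u_\varepsilon'(x)\big)'=f'(x)\ \text{ on }(0,1),\qquad u_\varepsilon(0)=u_\varepsilon(1)=0,$$ has a unique solution $u_\varepsilon\in C^1([0,1])$. The functions $x\mapsto \mathrm{Cov}(\frac1{a(x)},\frac1{a(0)})$ and $x\mapsto e^{\mathcal C(x)}-1$ are integrable on $\mathbb R$, and $$\mathcal Q:=\int_{\mathbb R}\mathrm{Cov}\Big(\frac1{a(x)},\frac1{a(0)}\Big)dx=e^{\mathcal C(0)}\int_{\mathbb R}\big(e^{\mathcal C(x)}-1\big)dx>0 .$$ Moreover there is a constant $K$ (depending on the field $G$ and on $\beta$,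 but not on $f,g,\varepsilon$) such that the following holds for all $f,g\in C^1([0,1])$ and all $\varepsilon>0$. Let $u_\varepsilon$ be the solution of the above problem, let $v_\varepsilon$ be the solution with $f$ replaced by $g$, and set $$I_\varepsilon(f,g):=\int_0^1u_\varepsilon'(x)g(x)\,dx,\qquad \sigma_\varepsilon(f,g):=\sqrt{\varepsilon^{-1}\mathrm{Var}\, I_\varepsilon(f,g)} .$$ Then almost surely $I_\varepsilon(f,g)=\int_0^1v_\varepsilon'(x)f(x)\,dx$, the random variable $I_\varepsilon(f,g)$ is square integrable, and $$\big|\sigma_\varepsilon(f,g)^2-\sigma(f,g)^2\big|\le K\,\|f\|_{C^1([0,1])}^2\,\|g\|_{C^1([0,1])}^2\;\varepsilon^{\min\{\frac12,\beta-1\}},$$ where $$\sigma(f,g)^2:=\mathcal Q\int_0^1\Big(f-\int_0^1f\Big)^2\Big(g-\int_0^1g\Big)^2,\qquad \|f\|_{C^1([0,1])}:=\sup_{[0,1]}|f|+\sup_{[0,1]}|f'| .$$ -/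

import Mathlib

open MeasureTheory ProbabilityTheory Set

namespace LogNormalHomogenization

noncomputable section

/-- `G` is a centered Gaussian random field on `ℝ` (all finite-dimensional marginals are Gaussian)
with covariance `E[G(x)G(y)] = C(x - y)`. For a centered Gaussian field, depending on `x - y` only
is stationarity. -/
structure IsStationaryGaussianField {Ω : Type*} [MeasurableSpace Ω] (P : Measure Ω)
    (G : ℝ → Ω → ℝ) (C : ℝ → ℝ) : Prop where
  gaussian : IsGaussianProcess G P
  mean_zero : ∀ x, P[G x] = 0
  cov_eq : ∀ x y, cov[G x, G y; P] = C (x - y)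

/-- The log-normal coefficient field `a(x) = exp(G(x))`. -/
def coeff {Ω : Type*} (G : ℝ → Ω → ℝ) (x : ℝ) (ω : Ω) : ℝ := Real.exp (G x ω)

/-- `u ∈ C¹([0,1])` solves `(a(x/ε) u'(x))' = f'(x)` on `(0,1)`, `u(0) = u(1) = 0`, for one
realization `a : ℝ → ℝ` of the coefficient. -/
structure IsSolution (a : ℝ → ℝ) (ε : ℝ) (f u : ℝ → ℝ) : Prop where
  contDiffOn : ContDiffOn ℝ 1 u (Icc 0 1)
  equation : ∀ x ∈ Ioo (0 : ℝ) 1,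
    HasDerivAt (fun y => a (y / ε) * derivWithin u (Icc 0 1) y) (derivWithin f (Icc 0 1) x) x
  left : u 0 = 0
  right : u 1 = 0

/-- The observable `∫₀¹ u'(x) g(x) dx`. -/
def observable (u g : ℝ → ℝ) : ℝ := ∫ x in (0 : ℝ)..1, derivWithin u (Icc 0 1) x * g x

/-- `σ_ε = sqrt (ε⁻¹ Var I)` for a random variable `I`. -/
def sigmaEps {Ω : Type*} [MeasurableSpace Ω] (P : Measure Ω) (ε : ℝ) (I : Ω → ℝ) : ℝ :=
  Real.sqrt (ε⁻¹ * Var[I; P])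

/-- The covariance `c(x) = Cov(1/a(x), 1/a(0))`. -/
def covInv {Ω : Type*} [MeasurableSpace Ω] (P : Measure Ω) (G : ℝ → Ω → ℝ) (x : ℝ) : ℝ :=
  cov[fun ω => 1 / coeff G x ω, fun ω => 1 / coeff G 0 ω; P]

/-- `𝒬 = ∫_ℝ Cov(1/a(x), 1/a(0)) dx`. -/
def limQ {Ω : Type*} [MeasurableSpace Ω] (P : Measure Ω) (G : ℝ → Ω → ℝ) : ℝ :=
  ∫ x, covInv P G x

/-- The limiting variance `σ²(f,g) = 𝒬 ∫₀¹ (f - ∫₀¹ f)² (g - ∫₀¹ g)²`. -/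
def sigmaSq {Ω : Type*} [MeasurableSpace Ω] (P : Measure Ω) (G : ℝ → Ω → ℝ) (f g : ℝ → ℝ) : ℝ :=
  limQ P G * ∫ x in (0 : ℝ)..1,
    (f x - ∫ y in (0 : ℝ)..1, f y) ^ 2 * (g x - ∫ y in (0 : ℝ)..1, g y) ^ 2

/-- The norm of `C¹([0,1])`: `sup |f| + sup |f'|`. -/
def normC1 (f : ℝ → ℝ) : ℝ :=
  (⨆ x : Icc (0 : ℝ) 1, |f x|) + ⨆ x : Icc (0 : ℝ) 1, |derivWithin f (Icc 0 1) x|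

end

end LogNormalHomogenization

open LogNormalHomogenization

/-!
With `w = 1 / a(· / ε)`, the equation says that `u' = w (f - m)` for a constant `m`, and the
boundary conditions make `m` the `w`-weighted mean of `f`. Hence `I_ε(f, g)` is the `w`-weighted
covariance of `f` and `g`. It does not change when constants are added to `f` and `g`, which may
therefore be assumed to have mean zero.

Split `w = exp (C 0 / 2) + Z(· / ε)`, where `Z` is the fluctuation of `1 / a`. The weighted
covariance becomes a deterministic constant plus the linear term `∫ f g Z(· / ε)` minus the
quadratic remainder `(∫ f Z(· / ε)) (∫ g Z(· / ε)) / ∫ w`. The variance of the linear term is `ε`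
times the integral of `c(z) = Cov(1 / a(z), 1 / a(0))` against the autocorrelation of `f g` at
`ε z`. The autocorrelation at `t` differs from its value at `0` by `O(min 1 |t|)`, and `c` inherits
the decay of `C`, so replacing it by its value at `0` costs `O(ε ^ (b - 1))` after division by `ε`,
where `b = min β (3 / 2)`. The four-point correlations of `Z` are explicit polynomials in the values
of `exp C - 1` in which each of the four points occurs, so the remainder has second moment `O(ε²)`.

For the positivity of the limit, `exp C - 1 ≥ C`, and `∫ C ≥ 0` as a limit of variances.
-/

namespace LogNormalHomogenization

section RandomIntegral

variable {Ω S : Type*} [MeasurableSpace Ω] [MeasurableSpace S] {P : Measure Ω} [SFinite P]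
  {μ : Measure S} {Z : S → Ω → ℝ} {M : ℝ}

lemma memLp_uncurry_of_integral_sq_le [IsFiniteMeasure μ] (hZ : Measurable (Function.uncurry Z))
    (hZ2 : ∀ s, MemLp (Z s) 2 P) (hM : ∀ s, ∫ ω, Z s ω ^ 2 ∂P ≤ M) :
    MemLp (Function.uncurry Z) 2 (μ.prod P) := by
  have hsq : Measurable fun q : S × Ω => Function.uncurry Z q ^ 2 := hZ.pow_const 2
  rw [memLp_two_iff_integrable_sq hZ.aestronglyMeasurable,
    integrable_prod_iff hsq.aestronglyMeasurable]
  refine ⟨.of_forall fun s => (hZ2 s).integrable_sq, Integrable.of_bound (C := M)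
    hsq.norm.stronglyMeasurable.integral_prod_right'.aestronglyMeasurable
    (.of_forall fun s => ?_)⟩
  simp only [Function.uncurry_apply_pair, Real.norm_eq_abs, abs_sq]
  exact (abs_of_nonneg (integral_nonneg fun ω => sq_nonneg (Z s ω))).trans_le (hM s)

variable [IsProbabilityMeasure μ]

lemma integrable_mul_pair (hZ : MemLp (Function.uncurry Z) 2 (μ.prod P)) :
    Integrable (fun q : (S × S) × Ω => Z q.1.1 q.2 * Z q.1.2 q.2) ((μ.prod μ).prod P) :=
  (hZ.comp_measurePreserving (measurePreserving_fst.prod (.id P))).integrable_mul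
    (hZ.comp_measurePreserving (measurePreserving_snd.prod (.id P)))

lemma memLp_two_integral (hZ : MemLp (Function.uncurry Z) 2 (μ.prod P)) :
    MemLp (fun ω => ∫ s, Z s ω ∂μ) 2 P := by
  have hm : AEStronglyMeasurable (fun ω => ∫ s, Z s ω ∂μ) P :=
    hZ.aestronglyMeasurable.prod_swap.integral_prod_right'
  rw [memLp_two_iff_integrable_sq hm]
  refine (integrable_mul_pair hZ).integral_prod_right.congr (.of_forall fun ω => ?_)
  simpa only [sq] using integral_prod_mul (μ := μ) (ν := μ) (fun s => Z s ω) fun s => Z s ω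

lemma integral_integral_sq (hZ : MemLp (Function.uncurry Z) 2 (μ.prod P)) :
    ∫ ω, (∫ s, Z s ω ∂μ) ^ 2 ∂P = ∫ p, ∫ ω, Z p.1 ω * Z p.2 ω ∂P ∂(μ.prod μ) := by
  rw [integral_integral_swap (f := fun (p : S × S) ω => Z p.1 ω * Z p.2 ω)
    (integrable_mul_pair hZ)]
  refine integral_congr_ae (.of_forall fun ω => ?_)
  simpa only [sq] using (integral_prod_mul (μ := μ) (ν := μ) (fun s => Z s ω) fun s => Z s ω).symm

lemma integral_prod_le_of_forall_left {T : Type*} [MeasurableSpace T] {ν : Measure T} [SFinite ν]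
    {F : S × T → ℝ} {c : ℝ} (hF : Integrable F (μ.prod ν)) (h : ∀ s, ∫ t, F (s, t) ∂ν ≤ c) :
    ∫ q, F q ∂(μ.prod ν) ≤ c := by
  rw [integral_prod _ hF]
  exact (integral_mono hF.integral_prod_left (integrable_const c) h).trans_eq (by simp)

end RandomIntegral

section SchurKernel

variable {Ω S : Type*} [MeasurableSpace Ω] [MeasurableSpace S] {P : Measure Ω} {μ : Measure S}
  {k : S → S → ℝ} {L : ℝ}

/-- A bounded, nonnegative, symmetric kernel whose row integrals are at most `L` (the hypothesis of
Schur's test). It dominates the correlations of a random field, and `L` plays the role of its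
correlation length. -/
structure IsSchurKernel (μ : Measure S) (k : S → S → ℝ) (L : ℝ) : Prop where
  measurable : Measurable (Function.uncurry k)
  nonneg : ∀ s t, 0 ≤ k s t
  symm : ∀ s t, k s t = k t s
  bdd : ∃ R, ∀ s t, k s t ≤ R
  integral_le : ∀ s, ∫ t, k s t ∂μ ≤ L

/-- The bound for the covariance of `Z p.1 * Z p.2` and `Z q.1 * Z q.2` in terms of the correlation
kernel `k` of the field `Z`: the three pairings of the four points, followed by the paths of length
two that join the pair `p` to the pair `q`. -/
def pairSum (k : S → S → ℝ) (p q : S × S) : ℝ :=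
  k p.1 p.2 * k q.1 q.2 + k p.1 q.1 * k p.2 q.2 + k p.2 q.1 * k p.1 q.2 +
    k p.1 q.1 * k p.1 q.2 + k p.2 q.1 * k p.2 q.2 + k p.1 q.1 * k p.2 q.1 + k p.1 q.2 * k p.2 q.2

namespace IsSchurKernel

lemma bound_nonneg [IsProbabilityMeasure μ] (hk : IsSchurKernel μ k L) : 0 ≤ L := by
  obtain ⟨s⟩ := nonempty_of_isProbabilityMeasure μ
  exact (integral_nonneg (hk.nonneg s)).trans (hk.integral_le s)

lemma measurable_comp (hk : IsSchurKernel μ k L) {T : Type*} [MeasurableSpace T] {u v : T → S}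
    (hu : Measurable u) (hv : Measurable v) : Measurable fun x => k (u x) (v x) :=
  hk.measurable.comp (hu.prodMk hv)

lemma exists_pairSum_le (hk : IsSchurKernel μ k L) : ∃ B, ∀ p q, pairSum k p q ≤ B := by
  obtain ⟨R, hR⟩ := hk.bdd
  have hmul : ∀ s t s' t', k s t * k s' t' ≤ R * R := fun s t s' t' =>
    mul_le_mul (hR s t) (hR s' t') (hk.nonneg _ _) ((hk.nonneg s t).trans (hR s t))
  refine ⟨7 * (R * R), fun p q => ?_⟩
  unfold pairSum
  linarith [hmul p.1 p.2 q.1 q.2, hmul p.1 q.1 p.2 q.2, hmul p.2 q.1 p.1 q.2, hmul p.1 q.1 p.1 q.2,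
    hmul p.2 q.1 p.2 q.2, hmul p.1 q.1 p.2 q.1, hmul p.1 q.2 p.2 q.2]

lemma integrable_mul (hk : IsSchurKernel μ k L) {T : Type*}
    [MeasurableSpace T] {ν : Measure T} [IsFiniteMeasure ν] {u v u' v' : T → S}
    (hu : Measurable u) (hv : Measurable v) (hu' : Measurable u') (hv' : Measurable v') :
    Integrable (fun x => k (u x) (v x) * k (u' x) (v' x)) ν := by
  obtain ⟨R, hR⟩ := hk.bdd
  refine Integrable.of_bound (C := R * R)
    ((hk.measurable_comp hu hv).mul (hk.measurable_comp hu' hv')).aestronglyMeasurable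
    (.of_forall fun x => ?_)
  rw [norm_mul, Real.norm_of_nonneg (hk.nonneg _ _), Real.norm_of_nonneg (hk.nonneg _ _)]
  exact mul_le_mul (hR _ _) (hR _ _) (hk.nonneg _ _) ((hk.nonneg (u x) (v x)).trans (hR _ _))

lemma integral_mul_integral_le [IsProbabilityMeasure μ] (hk : IsSchurKernel μ k L) (s t : S) :
    (∫ x, k s x ∂μ) * ∫ x, k t x ∂μ ≤ L ^ 2 := by
  rw [sq]
  exact mul_le_mul (hk.integral_le s) (hk.integral_le t) (integral_nonneg (hk.nonneg t))
    hk.bound_nonneg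

lemma integral_prod_mul_le [IsProbabilityMeasure μ] (hk : IsSchurKernel μ k L) (s t : S) :
    ∫ q, k s q.1 * k t q.2 ∂(μ.prod μ) ≤ L ^ 2 :=
  (integral_prod_mul (k s) (k t)).trans_le (hk.integral_mul_integral_le s t)

lemma integrable [IsProbabilityMeasure μ] (hk : IsSchurKernel μ k L) :
    Integrable (Function.uncurry k) (μ.prod μ) := by
  obtain ⟨R, hR⟩ := hk.bdd
  refine Integrable.of_bound (C := R) hk.measurable.aestronglyMeasurable (.of_forall fun q => ?_)
  exact (Real.norm_of_nonneg (hk.nonneg q.1 q.2)).trans_le (hR q.1 q.2)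

lemma integral_prod_le [IsProbabilityMeasure μ] (hk : IsSchurKernel μ k L) :
    ∫ q, k q.1 q.2 ∂(μ.prod μ) ≤ L :=
  integral_prod_le_of_forall_left hk.integrable hk.integral_le

lemma integrable_pairSum [IsProbabilityMeasure μ] (hk : IsSchurKernel μ k L) :
    Integrable (fun x : (S × S) × S × S => pairSum k x.1 x.2) ((μ.prod μ).prod (μ.prod μ)) := by
  unfold pairSum
  refine ((((((?_ : Integrable _ _).add ?_).add ?_).add ?_).add ?_).add ?_).add ?_ <;>
    exact hk.integrable_mul (by fun_prop) (by fun_prop) (by fun_prop) (by fun_prop)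

lemma integral_pairSum_le [IsProbabilityMeasure μ] (hk : IsSchurKernel μ k L) :
    ∫ x : (S × S) × S × S, pairSum k x.1 x.2 ∂((μ.prod μ).prod (μ.prod μ)) ≤ 7 * L ^ 2 := by
  have hint : ∀ {u v u' v' : (S × S) × S × S → S}, Measurable u → Measurable v → Measurable u' →
      Measurable v' → Integrable (fun x => k (u x) (v x) * k (u' x) (v' x))
        ((μ.prod μ).prod (μ.prod μ)) := fun hu hv hu' hv' => hk.integrable_mul hu hv hu' hv'
  have h_left : ∀ {i j : S × S → S}, Measurable i → Measurable j →
      ∫ x : (S × S) × S × S, k (i x.1) x.2.1 * k (j x.1) x.2.2 ∂((μ.prod μ).prod (μ.prod μ))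
        ≤ L ^ 2 := fun {i j} hi hj => integral_prod_le_of_forall_left
    (hint (by fun_prop) (by fun_prop) (by fun_prop) (by fun_prop))
    fun p => hk.integral_prod_mul_le (i p) (j p)
  have h_right : ∀ {i : S × S → S}, Measurable i →
      ∫ x : (S × S) × S × S, k x.1.1 (i x.2) * k x.1.2 (i x.2) ∂((μ.prod μ).prod (μ.prod μ))
        ≤ L ^ 2 := fun {i} hi => by
    rw [← integral_prod_swap]
    simpa only [Prod.fst_swap, Prod.snd_swap, hk.symm _ (i _)] using h_left hi hi
  have h_within : ∫ x : (S × S) × S × S, k x.1.1 x.1.2 * k x.2.1 x.2.2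
      ∂((μ.prod μ).prod (μ.prod μ)) ≤ L ^ 2 := by
    rw [integral_prod_mul (fun p : S × S => k p.1 p.2) fun q : S × S => k q.1 q.2, sq]
    exact mul_self_le_mul_self (integral_nonneg fun q => hk.nonneg _ _) hk.integral_prod_le
  unfold pairSum
  repeat rw [integral_add]
  · linarith [h_left measurable_fst measurable_snd, h_left measurable_snd measurable_fst,
      h_left measurable_fst measurable_fst, h_left measurable_snd measurable_snd,
      h_right measurable_fst, h_right measurable_snd]
  all_goals repeat' refine Integrable.add ?_ ?_
  all_goals exact hint (by fun_prop) (by fun_prop) (by fun_prop) (by fun_prop)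

lemma integral_integral_sq_le [SFinite P] [IsProbabilityMeasure μ] (hk : IsSchurKernel μ k L)
    {Z : S → Ω → ℝ} (hZ : MemLp (Function.uncurry Z) 2 (μ.prod P))
    (hcov : ∀ s t, |∫ ω, Z s ω * Z t ω ∂P| ≤ k s t) :
    ∫ ω, (∫ s, Z s ω ∂μ) ^ 2 ∂P ≤ L := by
  rw [integral_integral_sq hZ]
  exact (integral_mono (integrable_mul_pair hZ).integral_prod_left hk.integrable
    fun q => (le_abs_self _).trans (hcov q.1 q.2)).trans hk.integral_prod_le

lemma memLp_integral_sq_and_integral_le [SFinite P] [IsProbabilityMeasure μ]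
    (hk : IsSchurKernel μ k L) {Z : S → Ω → ℝ} {M : ℝ} (hM : 0 ≤ M)
    (hZ : Measurable (Function.uncurry Z))
    (hZ2 : ∀ s t, MemLp (fun ω => Z s ω * Z t ω) 2 P)
    (hcov : ∀ p q : S × S, |∫ ω, Z p.1 ω * Z p.2 ω * (Z q.1 ω * Z q.2 ω) ∂P| ≤
      M * pairSum k p q) :
    MemLp (fun ω => (∫ s, Z s ω ∂μ) ^ 2) 2 P ∧
      ∫ ω, ((∫ s, Z s ω ∂μ) ^ 2) ^ 2 ∂P ≤ M * (7 * L ^ 2) := by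
  obtain ⟨B, hB⟩ := hk.exists_pairSum_le
  have hW : MemLp (Function.uncurry fun (p : S × S) ω => Z p.1 ω * Z p.2 ω) 2
      ((μ.prod μ).prod P) := by
    refine memLp_uncurry_of_integral_sq_le (M := M * B) ?_ (fun p => hZ2 p.1 p.2) fun p => ?_
    · exact (hZ.comp (by fun_prop : Measurable fun x : (S × S) × Ω => (x.1.1, x.2))).mul
        (hZ.comp (by fun_prop : Measurable fun x : (S × S) × Ω => (x.1.2, x.2)))
    · simp only [sq]
      exact (le_abs_self _).trans ((hcov p p).trans (mul_le_mul_of_nonneg_left (hB p p) hM))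
  have hsq : ∀ ω, ∫ p, Z p.1 ω * Z p.2 ω ∂(μ.prod μ) = (∫ s, Z s ω ∂μ) ^ 2 := fun ω => by
    rw [sq, integral_prod_mul (fun s => Z s ω) fun s => Z s ω]
  simp only [← hsq]
  refine ⟨memLp_two_integral hW, ?_⟩
  rw [integral_integral_sq hW]
  calc ∫ x : (S × S) × S × S, ∫ ω, Z x.1.1 ω * Z x.1.2 ω * (Z x.2.1 ω * Z x.2.2 ω) ∂P
        ∂((μ.prod μ).prod (μ.prod μ))
      ≤ ∫ x : (S × S) × S × S, M * pairSum k x.1 x.2 ∂((μ.prod μ).prod (μ.prod μ)) :=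
        integral_mono (integrable_mul_pair hW).integral_prod_left
          (hk.integrable_pairSum.const_mul M) fun x => (le_abs_self _).trans (hcov x.1 x.2)
    _ ≤ M * (7 * L ^ 2) := by
        rw [integral_const_mul]
        exact mul_le_mul_of_nonneg_left hk.integral_pairSum_le hM

end IsSchurKernel

end SchurKernel

section PolynomialDecay

variable {ρ : ℝ → ℝ} {A B b β ε : ℝ}

lemma decay_const_nonneg (hdecay : ∀ z, |ρ z| ≤ B * (1 + |z|) ^ (-b)) : 0 ≤ B := by
  simpa using (abs_nonneg _).trans (hdecay 0)

lemma integrable_of_decay (hρ : Measurable ρ) (hb : 1 < b)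
    (hdecay : ∀ z, |ρ z| ≤ B * (1 + |z|) ^ (-b)) : Integrable ρ := by
  have h : Integrable fun z : ℝ => (1 + ‖z‖) ^ (-b) := integrable_one_add_norm (by simpa using hb)
  exact (h.const_mul B).mono' hρ.aestronglyMeasurable (.of_forall hdecay)

lemma decay_le_const (hb : 0 ≤ b) (hdecay : ∀ z, |ρ z| ≤ B * (1 + |z|) ^ (-b)) (z : ℝ) :
    |ρ z| ≤ B :=
  (hdecay z).trans (mul_le_of_le_one_right (decay_const_nonneg hdecay)
    (Real.rpow_le_one_of_one_le_of_nonpos (by linarith [abs_nonneg z]) (by linarith)))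

lemma decay_mono (hbβ : b ≤ β) (hdecay : ∀ z, |ρ z| ≤ B * (1 + |z|) ^ (-β)) (z : ℝ) :
    |ρ z| ≤ B * (1 + |z|) ^ (-b) :=
  (hdecay z).trans (mul_le_mul_of_nonneg_left
    (Real.rpow_le_rpow_of_exponent_le (by linarith [abs_nonneg z]) (by linarith))
    (decay_const_nonneg hdecay))

lemma decay_div_le (hb : 0 ≤ b) (hε : 0 < ε) (hdecay : ∀ z, |ρ z| ≤ B * (1 + |z|) ^ (-b)) {z : ℝ}
    (hz : z ≠ 0) : |ρ (z / ε)| ≤ B * ε ^ b * |z| ^ (-b) := by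
  have hz' : 0 < |z| := abs_pos.2 hz
  calc |ρ (z / ε)| ≤ B * (1 + |z / ε|) ^ (-b) := hdecay _
    _ ≤ B * (|z| / ε) ^ (-b) := by
        rw [abs_div, abs_of_pos hε]
        exact mul_le_mul_of_nonneg_left
          (Real.rpow_le_rpow_of_nonpos (by positivity) (by linarith) (by linarith))
          (decay_const_nonneg hdecay)
    _ = B * ε ^ b * |z| ^ (-b) := by
        rw [Real.div_rpow hz'.le hε.le, Real.rpow_neg hε.le, div_inv_eq_mul]
        ring

lemma abs_exp_sub_one_le_mul_exp (t : ℝ) : |Real.exp t - 1| ≤ |t| * Real.exp |t| := by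
  rcases le_total 0 t with ht | ht
  · rw [abs_of_nonneg ht, abs_of_nonneg (by linarith [Real.one_le_exp ht])]
    have h_inv : Real.exp t * Real.exp (-t) = 1 := by rw [← Real.exp_add]; simp
    nlinarith [Real.exp_pos t, Real.one_sub_le_exp_neg t]
  · rw [abs_of_nonpos ht, abs_of_nonpos (by linarith [Real.exp_le_one_iff.2 ht])]
    nlinarith [Real.add_one_le_exp t, Real.one_le_exp (neg_nonneg.2 ht)]

lemma decay_exp_sub_one (hb : 0 ≤ b) (hdecay : ∀ z, |ρ z| ≤ B * (1 + |z|) ^ (-b)) (z : ℝ) :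
    |Real.exp (ρ z) - 1| ≤ B * Real.exp B * (1 + |z|) ^ (-b) := by
  have hB := decay_const_nonneg hdecay
  refine (abs_exp_sub_one_le_mul_exp _).trans ?_
  rw [mul_right_comm]
  exact mul_le_mul (hdecay z) (Real.exp_le_exp.2 (decay_le_const hb hdecay z))
    (Real.exp_pos _).le (by positivity)

lemma integrable_abs_rpow_mul_min (hb : 1 < b) (hb' : b < 2) :
    Integrable fun t : ℝ => |t| ^ (-b) * min 1 |t| := by
  have h_near : IntegrableOn (fun t : ℝ => t ^ (-b) * min 1 t) (Ioc 0 1) := by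
    refine ((intervalIntegrable_iff_integrableOn_Ioc_of_le zero_le_one).1
      (intervalIntegral.intervalIntegrable_rpow' (r := 1 - b) (by linarith))).congr_fun
      (fun t ht => ?_) measurableSet_Ioc
    simp only [min_eq_right ht.2]
    rw [sub_eq_neg_add, Real.rpow_add_one ht.1.ne']
  have h_far : IntegrableOn (fun t : ℝ => t ^ (-b) * min 1 t) (Ioi 1) := by
    refine (integrableOn_Ioi_rpow_of_lt (neg_lt_neg hb) one_pos).congr_fun (fun t ht => ?_)
      measurableSet_Ioi
    simp only [min_eq_left (mem_Ioi.1 ht).le, mul_one]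
  have h_pos := h_near.union h_far
  rw [Ioc_union_Ioi_eq_Ioi zero_le_one] at h_pos
  have h_radial := integrable_fun_norm_addHaar (volume : Measure ℝ)
    (f := fun t : ℝ => t ^ (-b) * min 1 t)
  simp only [Module.finrank_self, tsub_self, pow_zero, one_smul, Real.norm_eq_abs] at h_radial
  exact h_radial.2 h_pos

end PolynomialDecay

section Autocorrelation

variable {h ρ : ℝ → ℝ} {B D b ε : ℝ}

lemma integral_comp_sub_div (ρ : ℝ → ℝ) (hε : 0 < ε) (x : ℝ) :
    ∫ y, ρ ((x - y) / ε) = ε * ∫ z, ρ z := by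
  rw [integral_sub_left_eq_self (fun z => ρ (z / ε)) volume x, Measure.integral_comp_div,
    abs_of_pos hε, smul_eq_mul]

/-- The autocorrelation function of `h`. It turns the double integral of `h ⊗ h` against a
convolution kernel into a single integral. -/
noncomputable def autocorr (h : ℝ → ℝ) (t : ℝ) : ℝ := ∫ x, h x * h (x + t)

lemma autocorr_zero (h : ℝ → ℝ) : autocorr h 0 = ∫ x, h x ^ 2 := by
  simp only [autocorr, add_zero, sq]

lemma integrable_shear (hhm : Measurable h) (hh : Integrable h) (hρm : Measurable ρ)
    (hρ : ∀ z, |ρ z| ≤ B) :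
    Integrable fun q : ℝ × ℝ => h q.2 * h (q.2 + q.1) * ρ q.1 := by
  have hint : Integrable fun p : ℝ × ℝ => h p.1 * h p.2 * ρ (p.1 - p.2) :=
    (hh.mul_prod hh).mul_bdd (hρm.comp (by fun_prop)).aestronglyMeasurable
      (.of_forall fun p => hρ _)
  refine ((measurePreserving_sub_prod volume volume).integrable_comp
    (by fun_prop)).1 (hint.congr (.of_forall fun p => ?_))
  simp only [Function.comp_apply, add_sub_cancel]
  ring

lemma integral_mul_mul_comp_sub (hhm : Measurable h) (hρm : Measurable ρ)
    (hint : Integrable fun q : ℝ × ℝ => h q.2 * h (q.2 + q.1) * ρ q.1) :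
    ∫ p : ℝ × ℝ, h p.1 * h p.2 * ρ (p.1 - p.2) = ∫ t, autocorr h t * ρ t := by
  have hmp := measurePreserving_sub_prod (volume : Measure ℝ) (volume : Measure ℝ)
  calc ∫ p : ℝ × ℝ, h p.1 * h p.2 * ρ (p.1 - p.2)
      = ∫ p : ℝ × ℝ, (fun q : ℝ × ℝ => h q.2 * h (q.2 + q.1) * ρ q.1) (p.1 - p.2, p.2) := by
        refine integral_congr_ae (.of_forall fun p => ?_)
        simp only [add_sub_cancel, mul_comm (h p.1)]
    _ = ∫ q : ℝ × ℝ, h q.2 * h (q.2 + q.1) * ρ q.1 := by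
        rw [Measure.volume_eq_prod]
        exact (integral_map (f := fun q : ℝ × ℝ => h q.2 * h (q.2 + q.1) * ρ q.1)
          hmp.aemeasurable (by fun_prop)).symm.trans (by rw [hmp.map_eq])
    _ = ∫ t, autocorr h t * ρ t := by
        rw [Measure.volume_eq_prod, integral_prod _ hint]
        simp only [integral_mul_const, autocorr]

lemma abs_integral_prod_comp_sub_div_sub_le (hb : 1 < b) (hb' : b < 2) (hε : 0 < ε)
    (hhm : Measurable h) (hh : Integrable h) (hρm : Measurable ρ)
    (hdecay : ∀ z, |ρ z| ≤ B * (1 + |z|) ^ (-b))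
    (hD : ∀ t, |autocorr h t - autocorr h 0| ≤ D * min 1 |t|) :
    |(∫ p : ℝ × ℝ, h p.1 * h p.2 * ρ ((p.1 - p.2) / ε)) - ε * (∫ z, ρ z) * ∫ x, h x ^ 2| ≤
      D * B * ε ^ b * ∫ t, |t| ^ (-b) * min 1 |t| := by
  have hρε : Measurable fun t => ρ (t / ε) := by fun_prop
  have hint := integrable_shear hhm hh hρε
    fun t => decay_le_const (by linarith) hdecay (t / ε)
  have h_corr : Integrable fun t => autocorr h t * ρ (t / ε) := by
    simpa only [autocorr, integral_mul_const] using hint.integral_prod_left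
  have h_ker : Integrable fun t => ρ (t / ε) := (integrable_of_decay hρm hb hdecay).comp_div hε.ne'
  have h_diff : (∫ p : ℝ × ℝ, h p.1 * h p.2 * ρ ((p.1 - p.2) / ε)) -
      ε * (∫ z, ρ z) * ∫ x, h x ^ 2 = ∫ t, (autocorr h t - autocorr h 0) * ρ (t / ε) := by
    simp only [sub_mul]
    rw [integral_sub h_corr (h_ker.const_mul _), integral_const_mul,
      integral_mul_mul_comp_sub hhm hρε hint, ← autocorr_zero, Measure.integral_comp_div,
      abs_of_pos hε, smul_eq_mul, mul_comm (autocorr h 0)]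
  rw [h_diff, ← integral_const_mul, ← Real.norm_eq_abs]
  refine norm_integral_le_of_norm_le ((integrable_abs_rpow_mul_min hb hb').const_mul _) ?_
  filter_upwards [compl_mem_ae_iff.2 (measure_singleton (0 : ℝ))] with t ht
  rw [norm_mul, Real.norm_eq_abs, Real.norm_eq_abs]
  calc |autocorr h t - autocorr h 0| * |ρ (t / ε)|
      ≤ D * min 1 |t| * (B * ε ^ b * |t| ^ (-b)) :=
        mul_le_mul (hD t) (decay_div_le (by linarith) hε hdecay ht) (abs_nonneg _)
          ((abs_nonneg _).trans (hD t))
    _ = D * B * ε ^ b * (|t| ^ (-b) * min 1 |t|) := by ring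

end Autocorrelation

section TestFunctions

variable {h k : ℝ → ℝ} {H K : ℝ}

/-- Lebesgue measure on the unit interval, as a probability measure on the real line. -/
noncomputable abbrev unitVolume : Measure ℝ := volume.restrict (Icc 0 1)

instance : IsProbabilityMeasure unitVolume := ⟨by simp [unitVolume]⟩

lemma intervalIntegral_eq_integral_unitVolume (h : ℝ → ℝ) :
    ∫ x in (0 : ℝ)..1, h x = ∫ x, h x ∂unitVolume := by
  rw [intervalIntegral.integral_of_le zero_le_one, integral_Icc_eq_integral_Ioc]

lemma integral_unitVolume_congr (h_eq : EqOn h k (Icc 0 1)) :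
    ∫ x, h x ∂unitVolume = ∫ x, k x ∂unitVolume :=
  setIntegral_congr_fun measurableSet_Icc h_eq

/-- A function supported in the unit interval that is bounded by `H` and `H`-Lipschitz there. It may
jump at the two endpoints, so that the indicator of the unit interval is allowed. -/
structure IsTestFunction (h : ℝ → ℝ) (H : ℝ) : Prop where
  eq_zero : ∀ x ∉ Icc (0 : ℝ) 1, h x = 0
  abs_le_of_mem : ∀ x ∈ Icc (0 : ℝ) 1, |h x| ≤ H
  abs_sub_le : ∀ x ∈ Icc (0 : ℝ) 1, ∀ y ∈ Icc (0 : ℝ) 1, |h x - h y| ≤ H * |x - y|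

lemma isTestFunction_indicator_one : IsTestFunction ((Icc 0 1).indicator 1) 1 where
  eq_zero _ hx := indicator_of_notMem hx 1
  abs_le_of_mem x hx := by simp [hx]
  abs_sub_le x hx y hy := by simp [hx, hy]

namespace IsTestFunction

lemma bound_nonneg (hh : IsTestFunction h H) : 0 ≤ H :=
  (abs_nonneg _).trans (hh.abs_le_of_mem 0 (left_mem_Icc.2 zero_le_one))

lemma abs_le (hh : IsTestFunction h H) (x : ℝ) : |h x| ≤ H := by
  by_cases hx : x ∈ Icc (0 : ℝ) 1
  · exact hh.abs_le_of_mem x hx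
  · simpa [hh.eq_zero x hx] using hh.bound_nonneg

lemma mul (hh : IsTestFunction h H) (hk : IsTestFunction k K) :
    IsTestFunction (fun x => h x * k x) (2 * (H * K)) where
  eq_zero x hx := by rw [hh.eq_zero x hx, zero_mul]
  abs_le_of_mem x _ := by
    have hHK := mul_nonneg hh.bound_nonneg hk.bound_nonneg
    rw [abs_mul]
    linarith [mul_le_mul (hh.abs_le x) (hk.abs_le x) (abs_nonneg _) hh.bound_nonneg]
  abs_sub_le x hx y hy :=
    calc |h x * k x - h y * k y| = |h x * (k x - k y) + (h x - h y) * k y| := by ring_nf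
      _ ≤ |h x| * |k x - k y| + |h x - h y| * |k y| := by
          simpa only [abs_mul] using abs_add_le (h x * (k x - k y)) ((h x - h y) * k y)
      _ ≤ H * (K * |x - y|) + H * |x - y| * K :=
          add_le_add
            (mul_le_mul (hh.abs_le x) (hk.abs_sub_le x hx y hy) (abs_nonneg _) hh.bound_nonneg)
            (mul_le_mul (hh.abs_sub_le x hx y hy) (hk.abs_le y) (abs_nonneg _)
              (mul_nonneg hh.bound_nonneg (abs_nonneg _)))
      _ = 2 * (H * K) * |x - y| := by ring

lemma continuousOn (hh : IsTestFunction h H) : ContinuousOn h (Icc 0 1) := by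
  refine (LipschitzOnWith.of_dist_le_mul (K := H.toNNReal) fun x hx y hy => ?_).continuousOn
  simpa only [Real.dist_eq, Real.coe_toNNReal _ hh.bound_nonneg] using hh.abs_sub_le x hx y hy

lemma measurable (hh : IsTestFunction h H) : Measurable h := by
  classical
  convert! hh.continuousOn.measurable_piecewise (g := 0) continuousOn_const measurableSet_Icc
    using 1
  ext x
  by_cases hx : x ∈ Icc (0 : ℝ) 1
  · rw [piecewise_eq_of_mem _ _ _ hx]
  · rw [piecewise_eq_of_notMem _ _ _ hx, hh.eq_zero x hx, Pi.zero_apply]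

lemma integrable_mul_of_abs_le (hh : IsTestFunction h H) {F : ℝ → ℝ} (hF : Measurable F)
    (hFK : ∀ x, |F x| ≤ K) : Integrable fun x => h x * F x := by
  have hh_int : Integrable h :=
    (integrableOn_iff_integrable_of_support_subset fun x hx => by
      by_contra hx'
      exact hx (hh.eq_zero x hx')).1
      (Integrable.of_bound hh.measurable.aestronglyMeasurable H (.of_forall hh.abs_le))
  exact hh_int.mul_bdd hF.aestronglyMeasurable (.of_forall hFK)

lemma integrable (hh : IsTestFunction h H) : Integrable h := by
  simpa using hh.integrable_mul_of_abs_le (F := fun _ => 1) (K := 1) measurable_const (by simp)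

lemma integral_unitVolume_mul (hh : IsTestFunction h H) (F : ℝ → ℝ) :
    ∫ x, h x * F x ∂unitVolume = ∫ x, h x * F x :=
  setIntegral_eq_integral_of_forall_compl_eq_zero fun x hx => by rw [hh.eq_zero x hx, zero_mul]

lemma integral_unitVolume_prod_mul (hh : IsTestFunction h H) (F : ℝ × ℝ → ℝ) :
    ∫ p, h p.1 * h p.2 * F p ∂(unitVolume.prod unitVolume) =
      ∫ p : ℝ × ℝ, h p.1 * h p.2 * F p := by
  rw [Measure.prod_restrict]
  refine setIntegral_eq_integral_of_forall_compl_eq_zero fun p hp => ?_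
  rcases not_and_or.1 hp with hp | hp <;> simp [hh.eq_zero _ hp]

/-- On the part of the unit interval that stays inside it under translation by `t` the Lipschitz
bound applies; the remaining part is an interval of length at most `|t|` at one of the ends. -/
lemma abs_mul_sub_le_indicator (hh : IsTestFunction h H) (t x : ℝ) :
    |h x * (h (x + t) - h x)| ≤ (Icc (0 : ℝ) 1).indicator (fun _ => H ^ 2 * |t|) x +
      ((Icc (1 - t) 1).indicator (fun _ => H ^ 2) x +
        (Icc 0 (-t)).indicator (fun _ => H ^ 2) x) := by
  have h_ends : ∀ s : Set ℝ, 0 ≤ s.indicator (fun _ => H ^ 2) x := fun s =>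
    indicator_nonneg (fun _ _ => sq_nonneg H) x
  by_cases hx : x ∈ Icc (0 : ℝ) 1
  swap
  · rw [hh.eq_zero x hx, zero_mul, abs_zero, indicator_of_notMem hx, zero_add]
    exact add_nonneg (h_ends _) (h_ends _)
  rw [indicator_of_mem hx, abs_mul]
  by_cases hxt : x + t ∈ Icc (0 : ℝ) 1
  · have h_lip := hh.abs_sub_le _ hxt x hx
    rw [add_sub_cancel_left] at h_lip
    have := mul_le_mul (hh.abs_le x) h_lip (abs_nonneg _) hh.bound_nonneg
    linarith [h_ends (Icc (1 - t) 1), h_ends (Icc 0 (-t))]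
  have h_jump : |h x| * |h (x + t) - h x| ≤ H ^ 2 := by
    rw [hh.eq_zero _ hxt, zero_sub, abs_neg, sq]
    exact mul_self_le_mul_self (abs_nonneg _) (hh.abs_le x)
  have h_shift : 0 ≤ H ^ 2 * |t| := by positivity
  rcases lt_or_ge (x + t) 0 with h_left | h_right
  · rw [indicator_of_mem (s := Icc 0 (-t)) ⟨hx.1, by linarith⟩]
    linarith [h_ends (Icc (1 - t) 1)]
  · have h_one : 1 < x + t := by
      by_contra! h_le
      exact hxt ⟨h_right, h_le⟩
    rw [indicator_of_mem (s := Icc (1 - t) 1) ⟨by linarith, hx.2⟩]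
    linarith [h_ends (Icc 0 (-t))]

lemma autocorr_sub_autocorr_zero (hh : IsTestFunction h H) (t : ℝ) :
    autocorr h t - autocorr h 0 = ∫ x, h x * (h (x + t) - h x) := by
  have hm := hh.measurable
  simp only [autocorr, add_zero, mul_sub]
  exact (integral_sub (hh.integrable_mul_of_abs_le (by fun_prop) fun x => hh.abs_le _)
    (hh.integrable_mul_of_abs_le hm hh.abs_le)).symm

lemma abs_autocorr_sub_le_abs (hh : IsTestFunction h H) (t : ℝ) :
    |autocorr h t - autocorr h 0| ≤ 2 * H ^ 2 * |t| := by
  have h_ind : ∀ a b c : ℝ, Integrable ((Icc a b).indicator fun _ : ℝ => c) := fun a b c =>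
    (integrable_indicator_iff measurableSet_Icc).2 (integrableOn_const (by simp))
  have h_int : ∀ a b c : ℝ, ∫ x, (Icc a b).indicator (fun _ : ℝ => c) x = max (b - a) 0 * c :=
    fun a b c => by
      rw [integral_indicator_const _ measurableSet_Icc, Real.volume_real_Icc, smul_eq_mul]
  rw [hh.autocorr_sub_autocorr_zero, ← Real.norm_eq_abs]
  refine (norm_integral_le_of_norm_le ((h_ind _ _ _).add ((h_ind _ _ _).add (h_ind _ _ _)))
    (.of_forall (hh.abs_mul_sub_le_indicator t))).trans_eq ?_
  rw [integral_add' (h_ind _ _ _) ((h_ind _ _ _).add (h_ind _ _ _)),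
    integral_add' (h_ind _ _ _) (h_ind _ _ _), h_int, h_int, h_int]
  have h_abs : max (1 - (1 - t)) 0 + max (-t - 0) 0 = |t| := by
    rcases le_total 0 t with ht | ht
    · rw [max_eq_left (by linarith), max_eq_right (by linarith), abs_of_nonneg ht]; ring
    · rw [max_eq_right (by linarith), max_eq_left (by linarith), abs_of_nonpos ht]; ring
  rw [← add_mul, h_abs, sub_zero, max_eq_left zero_le_one]
  ring

lemma abs_autocorr_sub_le (hh : IsTestFunction h H) (t : ℝ) :
    |autocorr h t - autocorr h 0| ≤ 2 * H ^ 2 * min 1 |t| := by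
  rcases le_total |t| 1 with ht | ht
  · rw [min_eq_right ht]
    exact hh.abs_autocorr_sub_le_abs t
  have h_bound : ∀ x, ‖h x * (h (x + t) - h x)‖ ≤ 2 * H ^ 2 := fun x =>
    calc ‖h x * (h (x + t) - h x)‖ = |h x| * |h (x + t) - h x| := abs_mul _ _
      _ ≤ H * (H + H) := mul_le_mul (hh.abs_le x)
          ((abs_sub _ _).trans (add_le_add (hh.abs_le _) (hh.abs_le _))) (abs_nonneg _)
          hh.bound_nonneg
      _ = 2 * H ^ 2 := by ring
  rw [min_eq_left ht, hh.autocorr_sub_autocorr_zero, ← hh.integral_unitVolume_mul]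
  simpa using norm_integral_le_of_norm_le_const (μ := unitVolume) (.of_forall h_bound)

end IsTestFunction

end TestFunctions

section StationaryFields

open Filter Topology

variable {Ω : Type*} [MeasurableSpace Ω] {P : Measure Ω} {Z : ℝ → Ω → ℝ} {c h : ℝ → ℝ}
  {B b ε H M : ℝ}

/-- A centered, square integrable process with continuous paths that is stationary in the wide
sense, with covariance function `c`. -/
structure IsStationaryField (P : Measure Ω) (Z : ℝ → Ω → ℝ) (c : ℝ → ℝ) : Prop where
  continuous : ∀ ω, Continuous fun x => Z x ω
  measurable : ∀ x, Measurable (Z x)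
  memLp : ∀ x, MemLp (Z x) 2 P
  mean_zero : ∀ x, ∫ ω, Z x ω ∂P = 0
  integral_mul : ∀ x y, ∫ ω, Z x ω * Z y ω ∂P = c (x - y)

/-- The field `Z`, rescaled to the microscopic length `ε`, tested against `h` on the unit
interval. -/
noncomputable def scaledIntegral {Ω : Type*} (Z : ℝ → Ω → ℝ) (ε : ℝ) (h : ℝ → ℝ) (ω : Ω) : ℝ :=
  ∫ x, h x * Z (x / ε) ω ∂unitVolume

lemma isSchurKernel_unitVolume (hc : Measurable c) (hc_int : Integrable c)
    (hc_even : ∀ x, c (-x) = c x) (hcB : ∀ x, |c x| ≤ B) (hε : 0 < ε) (H : ℝ) :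
    IsSchurKernel unitVolume (fun x y => H ^ 2 * |c ((x - y) / ε)|)
      (H ^ 2 * (ε * ∫ z, |c z|)) where
  measurable := by
    have : Measurable fun p : ℝ × ℝ => c ((p.1 - p.2) / ε) := by fun_prop
    simpa only [Function.uncurry_def, Real.norm_eq_abs] using this.norm.const_mul (H ^ 2)
  nonneg x y := by positivity
  symm x y := by rw [← hc_even, ← neg_div, neg_sub]
  bdd := ⟨H ^ 2 * B, fun x y => mul_le_mul_of_nonneg_left (hcB _) (sq_nonneg H)⟩
  integral_le x := by
    rw [integral_const_mul, ← integral_comp_sub_div (fun z => |c z|) hε x]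
    refine mul_le_mul_of_nonneg_left ?_ (sq_nonneg H)
    exact setIntegral_le_integral ((hc_int.abs.comp_div hε.ne').comp_sub_left x)
      (.of_forall fun y => abs_nonneg _)

namespace IsStationaryField

lemma measurable_uncurry (hZ : IsStationaryField P Z c) : Measurable (Function.uncurry Z) :=
  measurable_uncurry_of_continuous_of_measurable hZ.continuous hZ.measurable

lemma cov_even (hZ : IsStationaryField P Z c) (x : ℝ) : c (-x) = c x := by
  have := (hZ.integral_mul 0 x).symm.trans (integral_congr_ae (.of_forall fun ω => mul_comm _ _))
  rwa [hZ.integral_mul, zero_sub, sub_zero] at this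

lemma measurable_uncurry_scaled (hZ : IsStationaryField P Z c) (ε : ℝ) (hh : IsTestFunction h H) :
    Measurable (Function.uncurry fun x ω => h x * Z (x / ε) ω) :=
  (hh.measurable.comp measurable_fst).mul
    (hZ.measurable_uncurry.comp (by fun_prop : Measurable fun q : ℝ × Ω => (q.1 / ε, q.2)))

lemma integral_scaled_mul (hZ : IsStationaryField P Z c) (ε x y : ℝ) :
    ∫ ω, h x * Z (x / ε) ω * (h y * Z (y / ε) ω) ∂P = h x * h y * c ((x - y) / ε) := by
  rw [sub_div, ← hZ.integral_mul, ← integral_const_mul]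
  exact integral_congr_ae (.of_forall fun ω => by ring)

variable [IsProbabilityMeasure P]

lemma measurable_cov (hZ : IsStationaryField P Z c) : Measurable c := by
  have h_cov : c = fun x => ∫ ω, Function.uncurry Z (x, ω) * Z 0 ω ∂P := by
    ext x
    simpa using (hZ.integral_mul x 0).symm
  rw [h_cov]
  exact (hZ.measurable_uncurry.mul ((hZ.measurable 0).comp measurable_snd)
    ).stronglyMeasurable.integral_prod_right'.measurable

lemma memLp_uncurry_scaled (hZ : IsStationaryField P Z c) (ε : ℝ) (hh : IsTestFunction h H) :
    MemLp (Function.uncurry fun x ω => h x * Z (x / ε) ω) 2 (unitVolume.prod P) := by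
  refine memLp_uncurry_of_integral_sq_le (M := H ^ 2 * |c 0|) (hZ.measurable_uncurry_scaled ε hh)
    (fun x => (hZ.memLp _).const_mul _) fun x => ?_
  simp only [sq (_ * _)]
  rw [hZ.integral_scaled_mul, sub_self, zero_div, ← sq]
  exact (mul_le_mul_of_nonneg_left (le_abs_self _) (sq_nonneg _)).trans
    (mul_le_mul_of_nonneg_right (sq_le_sq' (abs_le.1 (hh.abs_le x)).1 (abs_le.1 (hh.abs_le x)).2)
      (abs_nonneg _))

lemma memLp_scaledIntegral (hZ : IsStationaryField P Z c) (ε : ℝ) (hh : IsTestFunction h H) :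
    MemLp (scaledIntegral Z ε h) 2 P :=
  memLp_two_integral (hZ.memLp_uncurry_scaled ε hh)

lemma integral_scaledIntegral (hZ : IsStationaryField P Z c) (ε : ℝ) (hh : IsTestFunction h H) :
    ∫ ω, scaledIntegral Z ε h ω ∂P = 0 := by
  unfold scaledIntegral
  rw [← integral_integral_swap ((hZ.memLp_uncurry_scaled ε hh).integrable one_le_two)]
  simp only [integral_const_mul, hZ.mean_zero, mul_zero, integral_zero]

lemma variance_scaledIntegral (hZ : IsStationaryField P Z c) (ε : ℝ) (hh : IsTestFunction h H) :
    Var[scaledIntegral Z ε h; P] = ∫ ω, scaledIntegral Z ε h ω ^ 2 ∂P :=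
  variance_of_integral_eq_zero (hZ.memLp_scaledIntegral ε hh).aemeasurable
    (hZ.integral_scaledIntegral ε hh)

lemma isSchurKernel (hZ : IsStationaryField P Z c) (hb : 1 < b) (hε : 0 < ε)
    (hdecay : ∀ z, |c z| ≤ B * (1 + |z|) ^ (-b)) (H : ℝ) :
    IsSchurKernel unitVolume (fun x y => H ^ 2 * |c ((x - y) / ε)|) (H ^ 2 * (ε * ∫ z, |c z|)) :=
  isSchurKernel_unitVolume hZ.measurable_cov (integrable_of_decay hZ.measurable_cov hb hdecay)
    hZ.cov_even (decay_le_const (by linarith) hdecay) hε H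

lemma integral_scaledIntegral_sq_le (hZ : IsStationaryField P Z c) (hb : 1 < b) (hε : 0 < ε)
    (hdecay : ∀ z, |c z| ≤ B * (1 + |z|) ^ (-b)) (hh : IsTestFunction h H) :
    ∫ ω, scaledIntegral Z ε h ω ^ 2 ∂P ≤ H ^ 2 * (ε * ∫ z, |c z|) := by
  refine (hZ.isSchurKernel hb hε hdecay H).integral_integral_sq_le (hZ.memLp_uncurry_scaled ε hh)
    fun x y => ?_
  rw [hZ.integral_scaled_mul, abs_mul, abs_mul, sq]
  exact mul_le_mul_of_nonneg_right
    (mul_le_mul (hh.abs_le x) (hh.abs_le y) (abs_nonneg _) hh.bound_nonneg) (abs_nonneg _)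

lemma abs_inv_mul_variance_scaledIntegral_sub_le (hZ : IsStationaryField P Z c) (hb : 1 < b)
    (hb' : b < 2) (hε : 0 < ε) (hdecay : ∀ z, |c z| ≤ B * (1 + |z|) ^ (-b))
    (hh : IsTestFunction h H) :
    |ε⁻¹ * Var[scaledIntegral Z ε h; P] - (∫ z, c z) * ∫ x, h x ^ 2| ≤
      2 * H ^ 2 * B * (∫ t, |t| ^ (-b) * min 1 |t|) * ε ^ (b - 1) := by
  have h_lim : |(∫ ω, scaledIntegral Z ε h ω ^ 2 ∂P) - ε * (∫ z, c z) * ∫ x, h x ^ 2| ≤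
      2 * H ^ 2 * B * ε ^ b * ∫ t, |t| ^ (-b) * min 1 |t| := by
    unfold scaledIntegral
    simp only [integral_integral_sq (hZ.memLp_uncurry_scaled ε hh), hZ.integral_scaled_mul]
    rw [hh.integral_unitVolume_prod_mul]
    exact abs_integral_prod_comp_sub_div_sub_le hb hb' hε hh.measurable hh.integrable
      hZ.measurable_cov hdecay hh.abs_autocorr_sub_le
  rw [← hZ.variance_scaledIntegral ε hh] at h_lim
  calc _ = ε⁻¹ * |Var[scaledIntegral Z ε h; P] - ε * (∫ z, c z) * ∫ x, h x ^ 2| := by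
        rw [← abs_of_pos (inv_pos.2 hε), ← abs_mul, abs_of_pos (inv_pos.2 hε), mul_sub,
          mul_assoc ε, inv_mul_cancel_left₀ hε.ne']
    _ ≤ ε⁻¹ * (2 * H ^ 2 * B * ε ^ b * ∫ t, |t| ^ (-b) * min 1 |t|) :=
        mul_le_mul_of_nonneg_left h_lim (inv_pos.2 hε).le
    _ = 2 * H ^ 2 * B * (∫ t, |t| ^ (-b) * min 1 |t|) * ε ^ (b - 1) := by
        rw [Real.rpow_sub_one hε.ne']
        ring

/-- After division by `ε`, the variance of the average of `Z` over an interval of length `1/ε`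
tends to the integral of `c`. -/
lemma integral_cov_nonneg (hZ : IsStationaryField P Z c) (hb : 1 < b) (hb' : b < 2)
    (hdecay : ∀ z, |c z| ≤ B * (1 + |z|) ^ (-b)) : 0 ≤ ∫ z, c z := by
  set D := 2 * 1 ^ 2 * B * ∫ t, |t| ^ (-b) * min 1 |t|
  have h_one : ∫ x : ℝ, (Icc (0 : ℝ) 1).indicator (1 : ℝ → ℝ) x ^ 2 = 1 := by
    have h_sq : ∀ x : ℝ, (Icc (0 : ℝ) 1).indicator (1 : ℝ → ℝ) x ^ 2 =
        (Icc (0 : ℝ) 1).indicator 1 x := fun x => by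
      by_cases hx : x ∈ Icc (0 : ℝ) 1 <;> simp [hx]
    simp only [h_sq, integral_indicator_one measurableSet_Icc, Real.volume_real_Icc]
    norm_num
  have h_lower : ∀ ε : ℝ, 0 < ε → 0 ≤ (∫ z, c z) + D * ε ^ (b - 1) := fun ε hε => by
    have h_est := (abs_le.1 (hZ.abs_inv_mul_variance_scaledIntegral_sub_le hb hb' hε hdecay
      isTestFunction_indicator_one)).2
    have h_var : 0 ≤ ε⁻¹ * Var[scaledIntegral Z ε ((Icc 0 1).indicator 1); P] :=
      mul_nonneg (inv_pos.2 hε).le (variance_nonneg _ _)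
    rw [h_one] at h_est
    linarith
  have h_pow_lim : Tendsto (fun ε : ℝ => ε ^ (b - 1)) (𝓝[>] 0) (𝓝 0) := by
    have := (Real.continuousAt_rpow_const 0 (b - 1) (.inr (by linarith))).tendsto
    rw [Real.zero_rpow (by linarith)] at this
    exact this.mono_left nhdsWithin_le_nhds
  have h_lim := (h_pow_lim.const_mul D).const_add (∫ z, c z)
  rw [mul_zero, add_zero] at h_lim
  exact ge_of_tendsto h_lim (eventually_mem_nhdsWithin.mono h_lower)

end IsStationaryField

/-- A stationary field whose four-point correlations decay like the pairings of its two-point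
correlations. -/
structure IsMixingField (P : Measure Ω) (Z : ℝ → Ω → ℝ) (c : ℝ → ℝ) (M : ℝ) : Prop
    extends IsStationaryField P Z c where
  memLp_mul : ∀ x y, MemLp (fun ω => Z x ω * Z y ω) 2 P
  const_nonneg : 0 ≤ M
  four_point : ∀ p q : ℝ × ℝ, |∫ ω, Z p.1 ω * Z p.2 ω * (Z q.1 ω * Z q.2 ω) ∂P| ≤
    M * pairSum (fun x y => |c (x - y)|) p q

lemma pairSum_const_mul {S : Type*} (a : ℝ) (k : S → S → ℝ) (p q : S × S) :
    pairSum (fun x y => a * k x y) p q = a ^ 2 * pairSum k p q := by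
  unfold pairSum
  ring

lemma IsMixingField.abs_integral_scaled_four_le (hZ : IsMixingField P Z c M) (ε : ℝ)
    (hh : IsTestFunction h H) (p q : ℝ × ℝ) :
    |∫ ω, h p.1 * Z (p.1 / ε) ω * (h p.2 * Z (p.2 / ε) ω) *
      (h q.1 * Z (q.1 / ε) ω * (h q.2 * Z (q.2 / ε) ω)) ∂P| ≤
      M * pairSum (fun x y => H ^ 2 * |c ((x - y) / ε)|) p q := by
  have h_two : ∀ r : ℝ × ℝ, |h r.1 * h r.2| ≤ H ^ 2 := fun r => by
    rw [abs_mul, sq]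
    exact mul_le_mul (hh.abs_le _) (hh.abs_le _) (abs_nonneg _) hh.bound_nonneg
  have h_scale : pairSum (fun x y => |c (x - y)|) (p.1 / ε, p.2 / ε) (q.1 / ε, q.2 / ε) =
      pairSum (fun x y => |c ((x - y) / ε)|) p q := by
    simp only [pairSum, sub_div]
  have h_four := hZ.four_point (p.1 / ε, p.2 / ε) (q.1 / ε, q.2 / ε)
  rw [h_scale] at h_four
  calc _ = |h p.1 * h p.2| * |h q.1 * h q.2| *
        |∫ ω, Z (p.1 / ε) ω * Z (p.2 / ε) ω * (Z (q.1 / ε) ω * Z (q.2 / ε) ω) ∂P| := by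
        rw [← abs_mul, ← abs_mul, ← integral_const_mul]
        exact congrArg _ (integral_congr_ae (.of_forall fun ω => by ring))
    _ ≤ H ^ 2 * H ^ 2 * (M * pairSum (fun x y => |c ((x - y) / ε)|) p q) :=
        mul_le_mul (mul_le_mul (h_two p) (h_two q) (abs_nonneg _) (sq_nonneg H)) h_four
          (abs_nonneg _) (by positivity)
    _ = M * pairSum (fun x y => H ^ 2 * |c ((x - y) / ε)|) p q := by
        rw [pairSum_const_mul]
        ring

lemma IsMixingField.memLp_scaledIntegral_sq_and_integral_le [IsProbabilityMeasure P]
    (hZ : IsMixingField P Z c M) (hb : 1 < b) (hε : 0 < ε)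
    (hdecay : ∀ z, |c z| ≤ B * (1 + |z|) ^ (-b)) (hh : IsTestFunction h H) :
    MemLp (fun ω => scaledIntegral Z ε h ω ^ 2) 2 P ∧
      ∫ ω, (scaledIntegral Z ε h ω ^ 2) ^ 2 ∂P ≤ M * (7 * (H ^ 2 * (ε * ∫ z, |c z|)) ^ 2) := by
  refine (hZ.isSchurKernel hb hε hdecay H).memLp_integral_sq_and_integral_le hZ.const_nonneg
    (hZ.measurable_uncurry_scaled ε hh) (fun x y => ?_) (hZ.abs_integral_scaled_four_le ε hh)
  refine ((hZ.memLp_mul (x / ε) (y / ε)).const_mul (h x * h y)).ae_eq (.of_forall fun ω => ?_)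
  ring

end StationaryFields

section SecondMoments

variable {Ω : Type*} [MeasurableSpace Ω] {P : Measure Ω} {X Y : Ω → ℝ} {p q ε γ : ℝ}

lemma integral_mul_le_of_integral_sq_le (hX : MemLp X 2 P) (hY : MemLp Y 2 P)
    (hX_nonneg : ∀ ω, 0 ≤ X ω) (hY_nonneg : ∀ ω, 0 ≤ Y ω) (hp : 0 ≤ p) (hq : 0 ≤ q)
    (hXp : ∫ ω, X ω ^ 2 ∂P ≤ p ^ 2) (hYq : ∫ ω, Y ω ^ 2 ∂P ≤ q ^ 2) :
    ∫ ω, X ω * Y ω ∂P ≤ p * q := by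
  have h_two : ENNReal.ofReal 2 = 2 := by simp
  have h_holder := integral_mul_le_Lp_mul_Lq_of_nonneg Real.HolderConjugate.two_two
    (.of_forall hX_nonneg) (.of_forall hY_nonneg) (by rwa [h_two]) (by rwa [h_two])
  simp only [Real.rpow_two, ← Real.sqrt_eq_rpow] at h_holder
  exact h_holder.trans (mul_le_mul (Real.sqrt_le_iff.2 ⟨hp, hXp⟩) (Real.sqrt_le_iff.2 ⟨hq, hYq⟩)
    (Real.sqrt_nonneg _) hp)

lemma abs_variance_sub_sub_variance_le [IsFiniteMeasure P] (hX : MemLp X 2 P) (hY : MemLp Y 2 P)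
    {t : ℝ} (ht : 0 < t) :
    |Var[fun ω => X ω - Y ω; P] - Var[X; P]| ≤ t * Var[X; P] + (t⁻¹ + 1) * Var[Y; P] := by
  have h_sub := variance_nonneg (fun ω => t * X ω - Y ω) P
  have h_add := variance_nonneg (fun ω => t * X ω + Y ω) P
  rw [variance_fun_sub (hX.const_mul t) hY, variance_const_mul, covariance_const_mul_left] at h_sub
  rw [variance_fun_add (hX.const_mul t) hY, variance_const_mul, covariance_const_mul_left] at h_add
  rw [variance_fun_sub hX hY]
  have hY_nonneg := variance_nonneg Y P
  have h_weight : t * (t * Var[X; P] + t⁻¹ * Var[Y; P]) = t ^ 2 * Var[X; P] + Var[Y; P] := by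
    field_simp
  have h_upper : 2 * cov[X, Y; P] ≤ t * Var[X; P] + t⁻¹ * Var[Y; P] :=
    le_of_mul_le_mul_left (by linarith) ht
  have h_lower : -(2 * cov[X, Y; P]) ≤ t * Var[X; P] + t⁻¹ * Var[Y; P] :=
    le_of_mul_le_mul_left (by linarith) ht
  rw [abs_le]
  constructor <;> linarith

/-- For small `ε` the weight `t = √ε` balances the two error terms. -/
lemma abs_inv_mul_variance_sub_sub_le [IsFiniteMeasure P] (hX : MemLp X 2 P) (hY : MemLp Y 2 P)
    (hp : 0 ≤ p) (hq : 0 ≤ q) (hε : 0 < ε) (hγ : 0 ≤ γ) (hγ' : γ ≤ 1 / 2)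
    (hXp : Var[X; P] ≤ p * ε) (hYp : Var[Y; P] ≤ p * ε) (hYq : Var[Y; P] ≤ q * ε ^ 2) :
    |ε⁻¹ * Var[fun ω => X ω - Y ω; P] - ε⁻¹ * Var[X; P]| ≤ (3 * p + 2 * q) * ε ^ γ := by
  rw [← mul_sub, abs_mul, abs_of_pos (inv_pos.2 hε)]
  rcases le_total ε 1 with hε1 | hε1
  · have h_var := variance_nonneg Y P
    have h_sqrt_pos : 0 < √ε := Real.sqrt_pos.2 hε
    have h_sqrt_inv : 1 ≤ (√ε)⁻¹ := (one_le_inv₀ h_sqrt_pos).2 (Real.sqrt_le_one.2 hε1)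
    have h_sqrt_le : √ε ≤ ε ^ γ := by
      rw [Real.sqrt_eq_rpow]
      exact Real.rpow_le_rpow_of_exponent_ge hε hε1 hγ'
    calc ε⁻¹ * |Var[fun ω => X ω - Y ω; P] - Var[X; P]|
        ≤ ε⁻¹ * (√ε * (p * ε) + ((√ε)⁻¹ + (√ε)⁻¹) * (q * ε ^ 2)) := by
          refine mul_le_mul_of_nonneg_left
            ((abs_variance_sub_sub_variance_le hX hY h_sqrt_pos).trans ?_) (by positivity)
          gcongr
      _ = (p + 2 * q) * √ε := by
          have h_sq : ε = √ε ^ 2 := (Real.sq_sqrt hε.le).symm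
          generalize √ε = t at *
          subst h_sq
          field_simp
          ring
      _ ≤ (3 * p + 2 * q) * ε ^ γ :=
          mul_le_mul (by linarith) h_sqrt_le h_sqrt_pos.le (by positivity)
  · calc ε⁻¹ * |Var[fun ω => X ω - Y ω; P] - Var[X; P]|
        ≤ ε⁻¹ * (1 * (p * ε) + (1⁻¹ + 1) * (p * ε)) := by
          refine mul_le_mul_of_nonneg_left
            ((abs_variance_sub_sub_variance_le hX hY one_pos).trans ?_) (by positivity)
          gcongr
      _ = 3 * p * 1 := by field_simp; ring
      _ ≤ (3 * p + 2 * q) * ε ^ γ :=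
          mul_le_mul (by linarith) (Real.one_le_rpow hε1 hγ) zero_le_one (by positivity)

end SecondMoments

section WeightedCovariance

variable {S : Type*} [MeasurableSpace S] {μ : Measure S} {w f g : S → ℝ} {m s x y H : ℝ}

/-- The covariance of `f` and `g` under the probability measure with density `w / ∫ w`, multiplied
by the mass `∫ w`. -/
noncomputable def weightedCov (μ : Measure S) (w f g : S → ℝ) : ℝ :=
  (∫ x, f x * g x * w x ∂μ) - (∫ x, f x * w x ∂μ) * (∫ x, g x * w x ∂μ) / ∫ x, w x ∂μ

lemma weightedCov_comm : weightedCov μ w f g = weightedCov μ w g f := by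
  simp only [weightedCov, mul_comm]

lemma integral_sub_const_mul_weight (hw : Integrable w μ)
    (hf : Integrable (fun x => f x * w x) μ) (a : ℝ) :
    ∫ x, (f x - a) * w x ∂μ = (∫ x, f x * w x ∂μ) - a * ∫ x, w x ∂μ := by
  simp only [sub_mul]
  rw [integral_sub hf (hw.const_mul a), integral_const_mul]

lemma integral_sub_const_mul_sub_const_mul_weight (hw : Integrable w μ)
    (hf : Integrable (fun x => f x * w x) μ) (hg : Integrable (fun x => g x * w x) μ)
    (hfg : Integrable (fun x => f x * g x * w x) μ) (a b : ℝ) :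
    ∫ x, (f x - a) * (g x - b) * w x ∂μ = (∫ x, f x * g x * w x ∂μ) -
      b * (∫ x, f x * w x ∂μ) - a * ((∫ x, g x * w x ∂μ) - b * ∫ x, w x ∂μ) := by
  have h_left : Integrable (fun x => f x * g x * w x - b * (f x * w x)) μ :=
    hfg.sub (hf.const_mul b)
  have h_right : Integrable (fun x => a * (g x * w x - b * w x)) μ :=
    (hg.sub (hw.const_mul b)).const_mul a
  rw [← integral_const_mul, ← integral_const_mul b, ← integral_sub hg (hw.const_mul b),
    ← integral_const_mul, ← integral_sub hfg (hf.const_mul b), ← integral_sub h_left h_right]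
  exact integral_congr_ae (.of_forall fun x => by ring)

lemma weightedCov_sub_const (hw : Integrable w μ) (hw_ne : ∫ x, w x ∂μ ≠ 0)
    (hf : Integrable (fun x => f x * w x) μ) (hg : Integrable (fun x => g x * w x) μ)
    (hfg : Integrable (fun x => f x * g x * w x) μ) (a b : ℝ) :
    weightedCov μ w (fun x => f x - a) (fun x => g x - b) = weightedCov μ w f g := by
  rw [weightedCov, weightedCov, integral_sub_const_mul_weight hw hf,
    integral_sub_const_mul_weight hw hg, integral_sub_const_mul_sub_const_mul_weight hw hf hg hfg]
  field_simp
  ring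

/-- The mean of `f` under the probability measure with density `w / ∫ w`. -/
noncomputable def weightedMean (μ : Measure S) (w f : S → ℝ) : ℝ :=
  (∫ x, f x * w x ∂μ) / ∫ x, w x ∂μ

lemma integral_sub_weightedMean_mul_weight (hw : Integrable w μ) (hw_ne : ∫ x, w x ∂μ ≠ 0)
    (hf : Integrable (fun x => f x * w x) μ) :
    ∫ x, (f x - weightedMean μ w f) * w x ∂μ = 0 := by
  rw [integral_sub_const_mul_weight hw hf, weightedMean, div_mul_cancel₀ _ hw_ne, sub_self]

lemma eq_weightedMean_of_integral_eq_zero (hw : Integrable w μ) (hw_ne : ∫ x, w x ∂μ ≠ 0)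
    (hf : Integrable (fun x => f x * w x) μ) {a : ℝ} (ha : ∫ x, (f x - a) * w x ∂μ = 0) :
    a = weightedMean μ w f := by
  rw [integral_sub_const_mul_weight hw hf] at ha
  rw [weightedMean, eq_div_iff hw_ne]
  linarith

lemma integral_sub_weightedMean_mul_mul_weight (hg : Integrable (fun x => g x * w x) μ)
    (hfg : Integrable (fun x => f x * g x * w x) μ) :
    ∫ x, (f x - weightedMean μ w f) * g x * w x ∂μ = weightedCov μ w f g := by
  simp only [sub_mul, mul_assoc (weightedMean μ w f)]
  rw [integral_sub hfg (hg.const_mul _), integral_const_mul, weightedCov, weightedMean]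
  ring

/-- If `s` is at least `m / 2`, bound `1 / s²` by `4 / m²`; otherwise `(s - m)²` is bounded below,
and `|x / s| ≤ H` suffices. -/
lemma sq_mul_div_le (hs : 0 < s) (hm : 0 < m) (hx : |x| ≤ H * s) :
    (x * y / s) ^ 2 ≤ 4 / m ^ 2 * (x ^ 2 * y ^ 2 + H ^ 2 * ((s - m) ^ 2 * y ^ 2)) := by
  rcases le_total (m / 2) s with h_large | h_small
  · have h_inv : (s ^ 2)⁻¹ ≤ 4 / m ^ 2 := by
      rw [← inv_div]
      exact inv_anti₀ (by positivity) (by nlinarith)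
    calc (x * y / s) ^ 2 = (s ^ 2)⁻¹ * (x ^ 2 * y ^ 2) := by rw [div_pow]; field_simp
      _ ≤ 4 / m ^ 2 * (x ^ 2 * y ^ 2 + H ^ 2 * ((s - m) ^ 2 * y ^ 2)) :=
          mul_le_mul h_inv (le_add_of_nonneg_right (by positivity)) (by positivity) (by positivity)
  · have h_dev : 1 ≤ 4 / m ^ 2 * (s - m) ^ 2 := by
      rw [div_mul_eq_mul_div, one_le_div (by positivity)]
      nlinarith
    have h_quot : (x / s) ^ 2 ≤ H ^ 2 := by
      rw [← sq_abs, abs_div, abs_of_pos hs]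
      exact pow_le_pow_left₀ (by positivity) ((div_le_iff₀ hs).2 hx) 2
    calc (x * y / s) ^ 2 = 1 * ((x / s) ^ 2 * y ^ 2) := by ring
      _ ≤ 4 / m ^ 2 * (s - m) ^ 2 * (H ^ 2 * y ^ 2) :=
          mul_le_mul h_dev (mul_le_mul_of_nonneg_right h_quot (sq_nonneg y)) (by positivity)
            (by positivity)
      _ = 4 / m ^ 2 * (H ^ 2 * ((s - m) ^ 2 * y ^ 2)) := by ring
      _ ≤ 4 / m ^ 2 * (x ^ 2 * y ^ 2 + H ^ 2 * ((s - m) ^ 2 * y ^ 2)) :=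
          mul_le_mul_of_nonneg_left (le_add_of_nonneg_left (by positivity)) (by positivity)

end WeightedCovariance

section RandomWeights

variable {Ω : Type*} {Z : ℝ → Ω → ℝ} {c f g h : ℝ → ℝ} {B b m ε F K H M : ℝ} {ω : Ω}

/-- The mass on the unit interval of the weight `m + Z (· / ε)`. -/
noncomputable def scaledMass {Ω : Type*} (Z : ℝ → Ω → ℝ) (m ε : ℝ) (ω : Ω) : ℝ :=
  m + scaledIntegral Z ε ((Icc 0 1).indicator 1) ω

/-- The quadratic part of the response of the weighted covariance of `f` and `g` to the fluctuation
`Z (· / ε)` of its weight. -/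
noncomputable def covRemainder {Ω : Type*} (Z : ℝ → Ω → ℝ) (m ε : ℝ) (f g : ℝ → ℝ) (ω : Ω) : ℝ :=
  scaledIntegral Z ε f ω * scaledIntegral Z ε g ω / scaledMass Z m ε ω

lemma IsTestFunction.integrable_mul_continuous (hh : IsTestFunction h H) {w : ℝ → ℝ}
    (hw : Continuous w) : Integrable (fun x => h x * w x) unitVolume :=
  (hh.continuousOn.mul hw.continuousOn).integrableOn_compact isCompact_Icc

lemma IsTestFunction.integral_mul_add (hh : IsTestFunction h H)
    (hZω : Continuous fun x => Z x ω) (m ε : ℝ) :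
    ∫ x, h x * (m + Z (x / ε) ω) ∂unitVolume =
      m * (∫ x, h x ∂unitVolume) + scaledIntegral Z ε h ω := by
  rw [scaledIntegral, ← integral_const_mul, ← integral_add]
  · exact integral_congr_ae (.of_forall fun x => by ring)
  · simpa only [mul_comm] using hh.integrable_mul_continuous (continuous_const (y := m))
  · exact hh.integrable_mul_continuous (hZω.comp (continuous_id.div_const ε))

lemma integral_unitVolume_add (hZω : Continuous fun x => Z x ω) (m ε : ℝ) :
    ∫ x, (m + Z (x / ε) ω) ∂unitVolume = scaledMass Z m ε ω := by
  have h_one : EqOn (fun x => (Icc (0 : ℝ) 1).indicator 1 x * (m + Z (x / ε) ω))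
      (fun x => m + Z (x / ε) ω) (Icc 0 1) := fun x hx => by simp [hx]
  have h_mean : ∫ x : ℝ, (Icc (0 : ℝ) 1).indicator (1 : ℝ → ℝ) x ∂unitVolume = 1 := by
    rw [integral_indicator_one measurableSet_Icc]
    simp [Measure.real, unitVolume]
  rw [← integral_unitVolume_congr h_one, isTestFunction_indicator_one.integral_mul_add hZω, h_mean,
    mul_one, scaledMass]

lemma weightedCov_unitVolume_eq (hZω : Continuous fun x => Z x ω) (m ε : ℝ)
    (hf : IsTestFunction f F) (hg : IsTestFunction g K) (hf_mean : ∫ x, f x ∂unitVolume = 0)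
    (hg_mean : ∫ x, g x ∂unitVolume = 0) :
    weightedCov unitVolume (fun x => m + Z (x / ε) ω) f g =
      m * (∫ x, f x * g x ∂unitVolume) +
        (scaledIntegral Z ε (fun x => f x * g x) ω - covRemainder Z m ε f g ω) := by
  rw [weightedCov, (hf.mul hg).integral_mul_add hZω, hf.integral_mul_add hZω,
    hg.integral_mul_add hZω, hf_mean, hg_mean, integral_unitVolume_add hZω, covRemainder]
  ring

lemma scaledMass_pos (hZω : Continuous fun x => Z x ω) (hpos : ∀ x, 0 < m + Z x ω) (ε : ℝ) :
    0 < scaledMass Z m ε ω := by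
  rw [← integral_unitVolume_add hZω, ← intervalIntegral_eq_integral_unitVolume]
  have h_cont : Continuous fun x => m + Z (x / ε) ω :=
    continuous_const.add (hZω.comp (continuous_id.div_const ε))
  exact intervalIntegral.intervalIntegral_pos_of_pos (h_cont.intervalIntegrable _ _)
    (fun x => hpos _) zero_lt_one

lemma abs_scaledIntegral_le_mul_scaledMass (hZω : Continuous fun x => Z x ω)
    (hpos : ∀ x, 0 < m + Z x ω) (ε : ℝ) (hh : IsTestFunction h H)
    (h_mean : ∫ x, h x ∂unitVolume = 0) :
    |scaledIntegral Z ε h ω| ≤ H * scaledMass Z m ε ω := by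
  have h_cont : Continuous fun x => H * (m + Z (x / ε) ω) :=
    continuous_const.mul (continuous_const.add (hZω.comp (continuous_id.div_const ε)))
  have h_eq : scaledIntegral Z ε h ω = ∫ x, h x * (m + Z (x / ε) ω) ∂unitVolume := by
    rw [hh.integral_mul_add hZω, h_mean, mul_zero, zero_add]
  rw [h_eq, ← integral_unitVolume_add hZω, ← integral_const_mul, ← Real.norm_eq_abs]
  refine norm_integral_le_of_norm_le (h_cont.integrableOn_Icc) (.of_forall fun x => ?_)
  rw [norm_mul, Real.norm_of_nonneg (hpos _).le]
  exact mul_le_mul_of_nonneg_right (hh.abs_le x) (hpos _).le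

lemma abs_covRemainder_le (hZω : Continuous fun x => Z x ω) (hpos : ∀ x, 0 < m + Z x ω) (ε : ℝ)
    (hf : IsTestFunction f F) (hf_mean : ∫ x, f x ∂unitVolume = 0) :
    |covRemainder Z m ε f g ω| ≤ F * |scaledIntegral Z ε g ω| := by
  have h_mass := scaledMass_pos hZω hpos ε
  rw [covRemainder, abs_div, abs_mul, abs_of_pos h_mass, div_le_iff₀ h_mass, mul_right_comm]
  exact mul_le_mul_of_nonneg_right
    (abs_scaledIntegral_le_mul_scaledMass hZω hpos ε hf hf_mean) (abs_nonneg _)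

lemma covRemainder_sq_le (hZω : Continuous fun x => Z x ω) (hpos : ∀ x, 0 < m + Z x ω) (ε : ℝ)
    (hm : 0 < m) (hf : IsTestFunction f F) (hf_mean : ∫ x, f x ∂unitVolume = 0) :
    covRemainder Z m ε f g ω ^ 2 ≤
      4 / m ^ 2 * (scaledIntegral Z ε f ω ^ 2 * scaledIntegral Z ε g ω ^ 2 +
        F ^ 2 * (scaledIntegral Z ε ((Icc 0 1).indicator 1) ω ^ 2 *
          scaledIntegral Z ε g ω ^ 2)) := by
  have := sq_mul_div_le (y := scaledIntegral Z ε g ω) (scaledMass_pos hZω hpos ε) hm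
    (abs_scaledIntegral_le_mul_scaledMass hZω hpos ε hf hf_mean)
  rwa [scaledMass, add_sub_cancel_left] at this

variable [MeasurableSpace Ω] {P : Measure Ω} [IsProbabilityMeasure P]

lemma IsStationaryField.memLp_covRemainder (hZ : IsStationaryField P Z c)
    (hpos : ∀ x ω, 0 < m + Z x ω) (ε : ℝ) (hf : IsTestFunction f F) (hg : IsTestFunction g K)
    (hf_mean : ∫ x, f x ∂unitVolume = 0) : MemLp (covRemainder Z m ε f g) 2 P := by
  refine ((hZ.memLp_scaledIntegral ε hg).const_mul F).mono ?_ (.of_forall fun ω => ?_)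
  · exact (((hZ.memLp_scaledIntegral ε hf).aemeasurable.mul
      (hZ.memLp_scaledIntegral ε hg).aemeasurable).div (aemeasurable_const.add
        (hZ.memLp_scaledIntegral ε isTestFunction_indicator_one).aemeasurable)).aestronglyMeasurable
  · rw [norm_mul, Real.norm_of_nonneg hf.bound_nonneg]
    exact abs_covRemainder_le (hZ.continuous ω) (hpos · ω) ε hf hf_mean

lemma IsStationaryField.integral_covRemainder_sq_le (hZ : IsStationaryField P Z c)
    (hpos : ∀ x ω, 0 < m + Z x ω) (hb : 1 < b) (hε : 0 < ε)
    (hdecay : ∀ z, |c z| ≤ B * (1 + |z|) ^ (-b)) (hf : IsTestFunction f F)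
    (hg : IsTestFunction g K) (hf_mean : ∫ x, f x ∂unitVolume = 0) :
    ∫ ω, covRemainder Z m ε f g ω ^ 2 ∂P ≤ (F * K) ^ 2 * (∫ z, |c z|) * ε := by
  calc ∫ ω, covRemainder Z m ε f g ω ^ 2 ∂P
      ≤ ∫ ω, F ^ 2 * scaledIntegral Z ε g ω ^ 2 ∂P := by
        refine integral_mono (hZ.memLp_covRemainder hpos ε hf hg hf_mean).integrable_sq
          ((hZ.memLp_scaledIntegral ε hg).integrable_sq.const_mul _) fun ω => ?_
        simp only
        rw [← sq_abs, ← sq_abs (scaledIntegral Z ε g ω), ← mul_pow]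
        exact pow_le_pow_left₀ (abs_nonneg _)
          (abs_covRemainder_le (hZ.continuous ω) (hpos · ω) ε hf hf_mean) 2
    _ ≤ F ^ 2 * (K ^ 2 * (ε * ∫ z, |c z|)) := by
        rw [integral_const_mul]
        exact mul_le_mul_of_nonneg_left (hZ.integral_scaledIntegral_sq_le hb hε hdecay hg)
          (sq_nonneg F)
    _ = (F * K) ^ 2 * (∫ z, |c z|) * ε := by ring

namespace IsMixingField

lemma integral_scaledIntegral_sq_mul_sq_le (hZ : IsMixingField P Z c M) (hb : 1 < b) (hε : 0 < ε)
    (hdecay : ∀ z, |c z| ≤ B * (1 + |z|) ^ (-b)) (hf : IsTestFunction f F)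
    (hg : IsTestFunction g K) :
    Integrable (fun ω => scaledIntegral Z ε f ω ^ 2 * scaledIntegral Z ε g ω ^ 2) P ∧
      ∫ ω, scaledIntegral Z ε f ω ^ 2 * scaledIntegral Z ε g ω ^ 2 ∂P ≤
        7 * M * (∫ z, |c z|) ^ 2 * (F * K) ^ 2 * ε ^ 2 := by
  have hM := hZ.const_nonneg
  set L := ∫ z, |c z|
  have h_sq : √(7 * M) ^ 2 = 7 * M := Real.sq_sqrt (by positivity)
  have h_four : ∀ {h : ℝ → ℝ} {H : ℝ}, IsTestFunction h H →
      MemLp (fun ω => scaledIntegral Z ε h ω ^ 2) 2 P ∧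
        ∫ ω, (scaledIntegral Z ε h ω ^ 2) ^ 2 ∂P ≤ (√(7 * M) * (H ^ 2 * (ε * L))) ^ 2 :=
    fun hh => (hZ.memLp_scaledIntegral_sq_and_integral_le hb hε hdecay hh).imp_right fun h_le =>
      h_le.trans_eq (by rw [mul_pow (√_), h_sq]; ring)
  obtain ⟨hf_mem, hf_le⟩ := h_four hf
  obtain ⟨hg_mem, hg_le⟩ := h_four hg
  refine ⟨hf_mem.integrable_mul hg_mem, ?_⟩
  calc _ ≤ √(7 * M) * (F ^ 2 * (ε * L)) * (√(7 * M) * (K ^ 2 * (ε * L))) :=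
        integral_mul_le_of_integral_sq_le hf_mem hg_mem (fun _ => sq_nonneg _)
          (fun _ => sq_nonneg _) (by positivity) (by positivity) hf_le hg_le
    _ = √(7 * M) ^ 2 * L ^ 2 * (F * K) ^ 2 * ε ^ 2 := by ring
    _ = 7 * M * L ^ 2 * (F * K) ^ 2 * ε ^ 2 := by rw [h_sq]

lemma integral_covRemainder_sq_le_sq (hZ : IsMixingField P Z c M)
    (hpos : ∀ x ω, 0 < m + Z x ω) (hm : 0 < m) (hb : 1 < b) (hε : 0 < ε)
    (hdecay : ∀ z, |c z| ≤ B * (1 + |z|) ^ (-b)) (hf : IsTestFunction f F)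
    (hg : IsTestFunction g K) (hf_mean : ∫ x, f x ∂unitVolume = 0) :
    ∫ ω, covRemainder Z m ε f g ω ^ 2 ∂P ≤
      56 * M * (∫ z, |c z|) ^ 2 / m ^ 2 * (F * K) ^ 2 * ε ^ 2 := by
  obtain ⟨h_int_fg, h_le_fg⟩ := hZ.integral_scaledIntegral_sq_mul_sq_le hb hε hdecay hf hg
  obtain ⟨h_int_g, h_le_g⟩ :=
    hZ.integral_scaledIntegral_sq_mul_sq_le hb hε hdecay isTestFunction_indicator_one hg
  calc ∫ ω, covRemainder Z m ε f g ω ^ 2 ∂P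
      ≤ ∫ ω, 4 / m ^ 2 * (scaledIntegral Z ε f ω ^ 2 * scaledIntegral Z ε g ω ^ 2 +
          F ^ 2 * (scaledIntegral Z ε ((Icc 0 1).indicator 1) ω ^ 2 *
            scaledIntegral Z ε g ω ^ 2)) ∂P :=
        integral_mono (hZ.memLp_covRemainder hpos ε hf hg hf_mean).integrable_sq
          ((h_int_fg.add (h_int_g.const_mul _)).const_mul _) fun ω =>
            covRemainder_sq_le (hZ.continuous ω) (hpos · ω) ε hm hf hf_mean
    _ = 4 / m ^ 2 * ((∫ ω, scaledIntegral Z ε f ω ^ 2 * scaledIntegral Z ε g ω ^ 2 ∂P) +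
          F ^ 2 * ∫ ω, scaledIntegral Z ε ((Icc 0 1).indicator 1) ω ^ 2 *
            scaledIntegral Z ε g ω ^ 2 ∂P) := by
        rw [integral_const_mul, integral_add h_int_fg (h_int_g.const_mul _), integral_const_mul]
    _ ≤ 4 / m ^ 2 * (7 * M * (∫ z, |c z|) ^ 2 * (F * K) ^ 2 * ε ^ 2 +
          F ^ 2 * (7 * M * (∫ z, |c z|) ^ 2 * (1 * K) ^ 2 * ε ^ 2)) := by gcongr
    _ = 56 * M * (∫ z, |c z|) ^ 2 / m ^ 2 * (F * K) ^ 2 * ε ^ 2 := by ring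

lemma abs_inv_mul_variance_sub_covRemainder_sub_le (hZ : IsMixingField P Z c M)
    (hpos : ∀ x ω, 0 < m + Z x ω) (hm : 0 < m) (hb : 1 < b) (hb' : b ≤ 3 / 2) (hε : 0 < ε)
    (hdecay : ∀ z, |c z| ≤ B * (1 + |z|) ^ (-b)) (hf : IsTestFunction f F)
    (hg : IsTestFunction g K) (hf_mean : ∫ x, f x ∂unitVolume = 0) :
    |ε⁻¹ * Var[fun ω => scaledIntegral Z ε (fun x => f x * g x) ω - covRemainder Z m ε f g ω; P] -
        ε⁻¹ * Var[scaledIntegral Z ε (fun x => f x * g x); P]| ≤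
      (12 * (∫ z, |c z|) + 112 * M * (∫ z, |c z|) ^ 2 / m ^ 2) * (F * K) ^ 2 * ε ^ (b - 1) := by
  have hM := hZ.const_nonneg
  have h_quad := hZ.memLp_covRemainder hpos ε hf hg hf_mean
  have h_quad_var := variance_le_expectation_sq h_quad.aestronglyMeasurable
  have h_lin_le : Var[scaledIntegral Z ε (fun x => f x * g x); P] ≤
      4 * (F * K) ^ 2 * (∫ z, |c z|) * ε := by
    rw [hZ.variance_scaledIntegral ε (hf.mul hg)]
    exact (hZ.integral_scaledIntegral_sq_le hb hε hdecay (hf.mul hg)).trans_eq (by ring)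
  have h_quad_le : Var[covRemainder Z m ε f g; P] ≤ 4 * (F * K) ^ 2 * (∫ z, |c z|) * ε := by
    have h_le := h_quad_var.trans
      (hZ.integral_covRemainder_sq_le hpos hb hε hdecay hf hg hf_mean)
    have h_nonneg : 0 ≤ (F * K) ^ 2 * (∫ z, |c z|) * ε := by positivity
    linarith
  have h_bound := abs_inv_mul_variance_sub_sub_le (hZ.memLp_scaledIntegral ε (hf.mul hg)) h_quad
    (by positivity) (by positivity) hε (sub_nonneg.2 hb.le) (by linarith : b - 1 ≤ 1 / 2)
    h_lin_le h_quad_le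
    (h_quad_var.trans (hZ.integral_covRemainder_sq_le_sq hpos hm hb hε hdecay hf hg hf_mean))
  exact h_bound.trans_eq (by ring)

/-- The linear part of the response, `∫ f g Z (· / ε)`, has variance of order `ε` and determines the
limit; the quadratic remainder has second moment of order `ε²`. -/
theorem exists_abs_variance_weightedCov_sub_le (hZ : IsMixingField P Z c M)
    (hpos : ∀ x ω, 0 < m + Z x ω) (hm : 0 < m) (hb : 1 < b) (hb' : b ≤ 3 / 2)
    (hdecay : ∀ z, |c z| ≤ B * (1 + |z|) ^ (-b)) :
    ∃ D, ∀ (f g : ℝ → ℝ) (F K ε : ℝ), IsTestFunction f F → IsTestFunction g K →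
      ∫ x, f x ∂unitVolume = 0 → ∫ x, g x ∂unitVolume = 0 → 0 < ε →
      MemLp (fun ω => weightedCov unitVolume (fun x => m + Z (x / ε) ω) f g) 2 P ∧
      |ε⁻¹ * Var[fun ω => weightedCov unitVolume (fun x => m + Z (x / ε) ω) f g; P] -
        (∫ z, c z) * ∫ x, (f x * g x) ^ 2| ≤ D * (F * K) ^ 2 * ε ^ (b - 1) := by
  refine ⟨12 * (∫ z, |c z|) + 112 * M * (∫ z, |c z|) ^ 2 / m ^ 2 +
    8 * B * ∫ t, |t| ^ (-b) * min 1 |t|, fun f g F K ε hf hg hf_mean hg_mean hε => ?_⟩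
  simp only [weightedCov_unitVolume_eq (hZ.continuous _) m ε hf hg hf_mean hg_mean]
  have h_diff : MemLp (fun ω => scaledIntegral Z ε (fun x => f x * g x) ω -
      covRemainder Z m ε f g ω) 2 P :=
    (hZ.memLp_scaledIntegral ε (hf.mul hg)).sub (hZ.memLp_covRemainder hpos ε hf hg hf_mean)
  refine ⟨(memLp_const (m * ∫ x, f x * g x ∂unitVolume)).add h_diff, ?_⟩
  rw [variance_const_add h_diff.aestronglyMeasurable]
  have h_quad := hZ.abs_inv_mul_variance_sub_covRemainder_sub_le hpos hm hb hb' hε hdecay hf hg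
    hf_mean
  have h_lin := hZ.abs_inv_mul_variance_scaledIntegral_sub_le hb (by linarith) hε hdecay
    (hf.mul hg)
  exact (abs_sub_le _ _ _).trans ((add_le_add h_quad h_lin).trans_eq (by ring))

end IsMixingField

end RandomWeights

section Modification

open Filter Topology

variable {Ω : Type*} [MeasurableSpace Ω] {P : Measure Ω} {G : ℝ → Ω → ℝ}

lemma exists_continuous_measurable_modification (hm : ∀ x, AEMeasurable (G x) P)
    (hcont : ∀ᵐ ω ∂P, Continuous fun x => G x ω) :
    ∃ G' : ℝ → Ω → ℝ, (∀ ω, Continuous fun x => G' x ω) ∧ (∀ x, Measurable (G' x)) ∧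
      ∀ᵐ ω ∂P, ∀ x, G' x ω = G x ω := by
  classical
  have h_good : ∀ᵐ ω ∂P, (Continuous fun x => G x ω) ∧
      ∀ q : ℚ, G q ω = (hm q).mk (G q) ω :=
    hcont.and (ae_all_iff.2 fun q => (hm q).ae_eq_mk)
  obtain ⟨N, hN_sub, hN_meas, hN_null⟩ := exists_measurable_superset_of_null (ae_iff.1 h_good)
  have h_compl : ∀ ω ∉ N, (Continuous fun x => G x ω) ∧ ∀ q : ℚ, G q ω = (hm q).mk (G q) ω := by
    intro ω hω
    by_contra h
    exact hω (hN_sub h)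
  refine ⟨fun x => Nᶜ.indicator (G x), fun ω => ?_, fun x => ?_, ?_⟩
  · by_cases hω : ω ∈ N
    · simp [hω, continuous_const]
    · simpa [hω] using (h_compl ω hω).1
  · obtain ⟨q, hq⟩ : ∃ q : ℕ → ℚ, Tendsto (fun n => (q n : ℝ)) atTop (𝓝 x) := by
      have hx : x ∈ closure (range ((↑) : ℚ → ℝ)) := Rat.isDenseEmbedding_coe_real.dense x
      obtain ⟨y, hy, hy_lim⟩ := mem_closure_iff_seq_limit.1 hx
      choose q hq using hy
      exact ⟨q, by simpa [hq] using hy_lim⟩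
    refine measurable_of_tendsto_metrizable
      (f := fun n => Nᶜ.indicator ((hm (q n)).mk (G (q n))))
      (fun n => (hm (q n)).measurable_mk.indicator hN_meas.compl) (tendsto_pi_nhds.2 fun ω => ?_)
    by_cases hω : ω ∈ N
    · simp [hω]
    · have h := ((h_compl ω hω).1.tendsto x).comp hq
      have h_mk : ∀ n, (hm (q n)).mk (G (q n)) ω = G (q n) ω :=
        fun n => ((h_compl ω hω).2 (q n)).symm
      simpa [hω, h_mk, Function.comp_def] using h
  · filter_upwards [measure_eq_zero_iff_ae_notMem.1 hN_null] with ω hω x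
    simp [hω]

end Modification

section GaussianMoments

open Filter Topology

variable {Ω : Type*} {G : ℝ → Ω → ℝ} {C : ℝ → ℝ} {ι : Type*}

lemma prod_exp_neg_eq (G : ℝ → Ω → ℝ) (s : Finset ι) (x : ι → ℝ) (ω : Ω) :
    ∏ i ∈ s, Real.exp (-G (x i) ω) = Real.exp (∑ i ∈ s, -1 * G (x i) ω) := by
  simp only [neg_one_mul, Real.exp_sum]

variable [MeasurableSpace Ω] {P : Measure Ω}

namespace IsStationaryGaussianField

lemma congr {G' : ℝ → Ω → ℝ} (hG : IsStationaryGaussianField P G C) (h : ∀ x, G x =ᵐ[P] G' x) :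
    IsStationaryGaussianField P G' C where
  gaussian := hG.gaussian.congr h
  mean_zero x := by rw [← integral_congr_ae (h x), hG.mean_zero]
  cov_eq x y := by
    rw [← hG.cov_eq x y, covariance, covariance, integral_congr_ae (h x), integral_congr_ae (h y)]
    refine integral_congr_ae ?_
    filter_upwards [h x, h y] with ω hx hy
    rw [hx, hy]

lemma memLp (hG : IsStationaryGaussianField P G C) (x : ℝ) : MemLp (G x) 2 P :=
  (hG.gaussian.hasGaussianLaw_eval x).memLp_two

lemma cov_even (hG : IsStationaryGaussianField P G C) (x : ℝ) : C (-x) = C x := by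
  simpa [hG.cov_eq] using covariance_comm (μ := P) (G 0) (G x)

lemma isStationaryField (hG : IsStationaryGaussianField P G C)
    (hG_cont : ∀ ω, Continuous fun x => G x ω) (hG_meas : ∀ x, Measurable (G x)) :
    IsStationaryField P G C where
  continuous := hG_cont
  measurable := hG_meas
  memLp := hG.memLp
  mean_zero := hG.mean_zero
  integral_mul x y := by
    rw [← hG.cov_eq x y, covariance, hG.mean_zero, hG.mean_zero]
    simp only [sub_zero]

lemma hasGaussianLaw_sum (hG : IsStationaryGaussianField P G C) (s : Finset ι) (c x : ι → ℝ) :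
    HasGaussianLaw (fun ω => ∑ i ∈ s, c i * G (x i) ω) P :=
  ((hG.gaussian.comp_right x).smul c).hasGaussianLaw_fun_sum

lemma variance_sum (hG : IsStationaryGaussianField P G C) (s : Finset ι) (c x : ι → ℝ) :
    Var[fun ω => ∑ i ∈ s, c i * G (x i) ω; P] =
      ∑ i ∈ s, ∑ j ∈ s, c i * c j * C (x i - x j) := by
  have := hG.gaussian.isProbabilityMeasure
  rw [variance_fun_sum' fun i _ => (hG.memLp (x i)).const_mul (c i)]
  refine Finset.sum_congr rfl fun i _ => Finset.sum_congr rfl fun j _ => ?_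
  rw [covariance_const_mul_left, covariance_const_mul_right, hG.cov_eq, mul_assoc]

lemma map_sum_eq_gaussianReal (hG : IsStationaryGaussianField P G C) (s : Finset ι)
    (c x : ι → ℝ) : P.map (fun ω => ∑ i ∈ s, c i * G (x i) ω) =
      gaussianReal 0 Var[fun ω => ∑ i ∈ s, c i * G (x i) ω; P].toNNReal := by
  have := hG.gaussian.isProbabilityMeasure
  have h_mean : ∫ ω, ∑ i ∈ s, c i * G (x i) ω ∂P = 0 := by
    rw [integral_finsetSum _ fun i _ => ((hG.memLp (x i)).integrable one_le_two).const_mul (c i)]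
    simp [integral_const_mul, hG.mean_zero]
  rw [(hG.hasGaussianLaw_sum s c x).map_eq_gaussianReal, h_mean]

lemma integrable_exp_sum (hG : IsStationaryGaussianField P G C) (s : Finset ι) (c x : ι → ℝ) :
    Integrable (fun ω => Real.exp (∑ i ∈ s, c i * G (x i) ω)) P := by
  have h := integrable_exp_mul_gaussianReal (μ := 0)
    (v := Var[fun ω => ∑ i ∈ s, c i * G (x i) ω; P].toNNReal) 1
  rw [← hG.map_sum_eq_gaussianReal,
    integrable_map_measure (by fun_prop) (hG.hasGaussianLaw_sum s c x).aemeasurable] at h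
  simpa [Function.comp_def] using h

lemma integral_exp_sum (hG : IsStationaryGaussianField P G C) (s : Finset ι) (c x : ι → ℝ) :
    ∫ ω, Real.exp (∑ i ∈ s, c i * G (x i) ω) ∂P =
      Real.exp ((∑ i ∈ s, ∑ j ∈ s, c i * c j * C (x i - x j)) / 2) := by
  have h := mgf_gaussianReal (hG.map_sum_eq_gaussianReal s c x) 1
  rw [mgf, Real.coe_toNNReal _ (variance_nonneg _ _), hG.variance_sum] at h
  simpa using h

lemma integral_cexp_sub (hG : IsStationaryGaussianField P G C) (x y : ℝ) :
    ∫ ω, Complex.exp ((G x ω - G y ω : ℝ) * Complex.I) ∂P = Real.exp (C (x - y) - C 0) := by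
  have h := charFun_gaussianReal (μ := 0)
    (v := Var[fun ω => ∑ i, ![1, -1] i * G (![x, y] i) ω; P].toNNReal) 1
  have h_symm : C (y - x) = C (x - y) := by rw [← hG.cov_even, neg_sub]
  rw [← hG.map_sum_eq_gaussianReal, charFun_apply_real,
    integral_map (hG.hasGaussianLaw_sum _ _ _).aemeasurable (by fun_prop),
    Real.coe_toNNReal _ (variance_nonneg _ _), hG.variance_sum] at h
  simp only [Fin.sum_univ_two, Matrix.cons_val_zero, Matrix.cons_val_one, sub_self, h_symm] at h
  convert! h using 2
  · ext ω
    congr 1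
    push_cast
    ring
  · push_cast
    congr 1
    ring

/-- Almost sure continuity of the paths makes the characteristic function
`exp (C x - C 0)` of `G x - G 0` tend to `1`. -/
lemma tendsto_cov_zero (hG : IsStationaryGaussianField P G C)
    (hG_cont : ∀ᵐ ω ∂P, Continuous fun x => G x ω) : Tendsto C (𝓝 0) (𝓝 (C 0)) := by
  have := hG.gaussian.isProbabilityMeasure
  have h_char : Tendsto (fun x => ∫ ω, Complex.exp ((G x ω - G 0 ω : ℝ) * Complex.I) ∂P) (𝓝 0)
      (𝓝 (∫ _, 1 ∂P)) := by
    refine tendsto_integral_filter_of_dominated_convergence (fun _ => 1)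
      (.of_forall fun x => ?_) (.of_forall fun x => ?_) (integrable_const _) ?_
    · have h_sub := (hG.gaussian.aemeasurable x).sub (hG.gaussian.aemeasurable 0)
      exact (Complex.measurable_exp.comp_aemeasurable
        ((Complex.measurable_ofReal.comp_aemeasurable h_sub).mul_const _)).aestronglyMeasurable
    · exact .of_forall fun ω => (Complex.norm_exp_ofReal_mul_I _).le
    · filter_upwards [hG_cont] with ω hω
      have : Continuous fun x => Complex.exp ((G x ω - G 0 ω : ℝ) * Complex.I) := by fun_prop
      simpa using this.tendsto 0
  simp only [hG.integral_cexp_sub, sub_zero, integral_const, probReal_univ, one_smul] at h_char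
  have h_exp : Tendsto (fun x => Real.exp (C x - C 0)) (𝓝 0) (𝓝 1) := by
    simpa only [Function.comp_def, Complex.ofReal_re, Complex.one_re] using
      (Complex.continuous_re.tendsto 1).comp h_char
  have h_log := ((Real.continuousAt_log one_ne_zero).tendsto.comp h_exp).add_const (C 0)
  simpa [Function.comp_def] using h_log

lemma cov_zero_pos (hG : IsStationaryGaussianField P G C)
    (hG_cont : ∀ᵐ ω ∂P, Continuous fun x => G x ω) (hG_ne : ¬ ∀ᵐ ω ∂P, ∀ x, G x ω = 0) :
    0 < C 0 := by
  have := hG.gaussian.isProbabilityMeasure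
  have h_var : ∀ x, Var[G x; P] = C 0 := fun x => by
    rw [← covariance_self (hG.memLp x).aemeasurable, hG.cov_eq, sub_self]
  refine ((variance_nonneg (G 0) P).trans_eq (h_var 0)).lt_of_ne' fun h_zero => hG_ne ?_
  have h_ae : ∀ x, ∀ᵐ ω ∂P, G x ω = 0 := fun x => by
    simpa [hG.mean_zero] using
      ae_eq_integral_of_variance_eq_zero (hG.memLp x) ((h_var x).trans h_zero)
  filter_upwards [hG_cont, ae_all_iff.2 fun q : ℚ => h_ae q] with ω hω h_rat x
  exact congrFun (Rat.isDenseEmbedding_coe_real.dense.equalizer hω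
    (continuous_const (y := (0 : ℝ))) (funext h_rat)) x

lemma integrable_prod_exp_neg (hG : IsStationaryGaussianField P G C) (s : Finset ι) (x : ι → ℝ) :
    Integrable (fun ω => ∏ i ∈ s, Real.exp (-G (x i) ω)) P := by
  simpa only [prod_exp_neg_eq] using hG.integrable_exp_sum s (fun _ => -1) x

lemma integral_prod_exp_neg (hG : IsStationaryGaussianField P G C) (s : Finset ι) (x : ι → ℝ) :
    ∫ ω, ∏ i ∈ s, Real.exp (-G (x i) ω) ∂P =
      ∏ i ∈ s, ∏ j ∈ s, Real.exp (C (x i - x j) / 2) := by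
  simp only [prod_exp_neg_eq, ← Real.exp_sum, ← Finset.sum_div]
  simpa using hG.integral_exp_sum s (fun _ => -1) x

end IsStationaryGaussianField

end GaussianMoments

section LogNormalFluctuation

variable {Ω : Type*} {G : ℝ → Ω → ℝ} {C : ℝ → ℝ} {ι : Type*}

/-- The fluctuation of `1 / a = exp (-G)` around its mean `exp (C 0 / 2)`. -/
noncomputable def fluct {Ω : Type*} (G : ℝ → Ω → ℝ) (C : ℝ → ℝ) (x : ℝ) (ω : Ω) : ℝ :=
  Real.exp (-G x ω) - Real.exp (C 0 / 2)

/-- The four-point correlation of the normalized fluctuation `exp (-G - C 0 / 2) - 1` in terms of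
the values `r = exp C - 1` at the six pairs of points: the sum of `∏ r` over the 41 graphs on four
vertices without isolated vertices. -/
def fourPoint (r₁₂ r₁₃ r₁₄ r₂₃ r₂₄ r₃₄ : ℝ) : ℝ :=
  r₁₂ * r₃₄ * ((1 + r₁₃) * (1 + r₁₄) * ((1 + r₂₃) * (1 + r₂₄))) +
  r₁₃ * r₂₄ * ((1 + r₁₄) * (1 + r₂₃) * (1 + r₁₂ + r₃₄)) +
  r₁₄ * r₂₃ * ((1 + r₁₂ + r₃₄) * (1 + r₁₃ + r₂₄)) +
  r₁₂ * r₁₃ * r₁₄ + r₁₂ * r₂₃ * r₂₄ + r₁₃ * r₂₃ * r₃₄ + r₁₄ * r₂₄ * r₃₄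

lemma abs_fourPoint_le_fourPoint_abs (r₁₂ r₁₃ r₁₄ r₂₃ r₂₄ r₃₄ : ℝ) :
    |fourPoint r₁₂ r₁₃ r₁₄ r₂₃ r₂₄ r₃₄| ≤ fourPoint |r₁₂| |r₁₃| |r₁₄| |r₂₃| |r₂₄| |r₃₄| := by
  have h_one : ∀ r : ℝ, |1 + r| ≤ 1 + |r| := fun r => by simpa using abs_add_le 1 r
  have h_two : ∀ r s : ℝ, |1 + r + s| ≤ 1 + |r| + |s| := fun r s =>
    (abs_add_le _ _).trans (add_le_add_left (h_one r) _)
  unfold fourPoint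
  iterate 6 refine (abs_add_le _ _).trans (add_le_add ?_ ?_)
  all_goals
    simp only [abs_mul]
    gcongr <;> first | exact h_one _ | exact h_two _ _

lemma abs_fourPoint_le {r₁₂ r₁₃ r₁₄ r₂₃ r₂₄ r₃₄ R : ℝ} (h₁₂ : |r₁₂| ≤ R) (h₁₃ : |r₁₃| ≤ R)
    (h₁₄ : |r₁₄| ≤ R) (h₂₃ : |r₂₃| ≤ R) (h₂₄ : |r₂₄| ≤ R) (h₃₄ : |r₃₄| ≤ R) :
    |fourPoint r₁₂ r₁₃ r₁₄ r₂₃ r₂₄ r₃₄| ≤ (1 + R) ^ 4 *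
      (|r₁₂| * |r₃₄| + |r₁₃| * |r₂₄| + |r₂₃| * |r₁₄| + |r₁₃| * |r₁₄| + |r₂₃| * |r₂₄| +
        |r₁₃| * |r₂₃| + |r₁₄| * |r₂₄|) := by
  have hR : 0 ≤ R := (abs_nonneg _).trans h₁₂
  have h_two : 1 + R + R ≤ (1 + R) ^ 2 := by nlinarith
  have h_one : R ≤ (1 + R) ^ 4 := by nlinarith [sq_nonneg R, sq_nonneg (R ^ 2 + R)]
  refine (abs_fourPoint_le_fourPoint_abs _ _ _ _ _ _).trans ?_
  calc fourPoint |r₁₂| |r₁₃| |r₁₄| |r₂₃| |r₂₄| |r₃₄|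
      ≤ |r₁₂| * |r₃₄| * ((1 + R) * (1 + R) * ((1 + R) * (1 + R))) +
        |r₁₃| * |r₂₄| * ((1 + R) * (1 + R) * (1 + R + R)) +
        |r₁₄| * |r₂₃| * ((1 + R + R) * (1 + R + R)) +
        R * |r₁₃| * |r₁₄| + R * |r₂₃| * |r₂₄| + |r₁₃| * |r₂₃| * R + |r₁₄| * |r₂₄| * R := by
        unfold fourPoint
        gcongr
    _ ≤ |r₁₂| * |r₃₄| * ((1 + R) * (1 + R) * ((1 + R) * (1 + R))) +
        |r₁₃| * |r₂₄| * ((1 + R) * (1 + R) * (1 + R) ^ 2) +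
        |r₁₄| * |r₂₃| * ((1 + R) ^ 2 * (1 + R) ^ 2) +
        (1 + R) ^ 4 * |r₁₃| * |r₁₄| + (1 + R) ^ 4 * |r₂₃| * |r₂₄| +
        |r₁₃| * |r₂₃| * (1 + R) ^ 4 + |r₁₄| * |r₂₄| * (1 + R) ^ 4 := by
        gcongr
    _ = _ := by ring

lemma exp_eq_exp_half_sq (t : ℝ) : Real.exp t = Real.exp (t / 2) ^ 2 := by
  rw [sq, ← Real.exp_add, add_halves]

lemma prod_fluct (s : Finset ι) (x : ι → ℝ) (ω : Ω) :
    ∏ i ∈ s, fluct G C (x i) ω = (-Real.exp (C 0 / 2)) ^ s.card *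
      ∑ t ∈ s.powerset, ∏ i ∈ t, -(Real.exp (C 0 / 2))⁻¹ * Real.exp (-G (x i) ω) := by
  rw [← Finset.prod_one_add, ← Finset.prod_const, ← Finset.prod_mul_distrib]
  refine Finset.prod_congr rfl fun i _ => ?_
  rw [fluct]
  field_simp
  ring

namespace IsStationaryGaussianField

variable [MeasurableSpace Ω] {P : Measure Ω}

lemma integrable_prod_fluct (hG : IsStationaryGaussianField P G C) (s : Finset ι) (x : ι → ℝ) :
    Integrable (fun ω => ∏ i ∈ s, fluct G C (x i) ω) P := by
  simp only [prod_fluct, Finset.prod_mul_distrib]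
  exact (integrable_finsetSum _ fun t _ =>
    (hG.integrable_prod_exp_neg t x).const_mul _).const_mul _

lemma integral_prod_fluct (hG : IsStationaryGaussianField P G C) (s : Finset ι) (x : ι → ℝ) :
    ∫ ω, ∏ i ∈ s, fluct G C (x i) ω ∂P = (-Real.exp (C 0 / 2)) ^ s.card *
      ∑ t ∈ s.powerset, ∏ i ∈ t,
        -(Real.exp (C 0 / 2))⁻¹ * ∏ j ∈ t, Real.exp (C (x i - x j) / 2) := by
  simp only [prod_fluct, Finset.prod_mul_distrib, integral_const_mul]
  rw [integral_finsetSum _ fun t _ => (hG.integrable_prod_exp_neg t x).const_mul _]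
  simp only [integral_const_mul, hG.integral_prod_exp_neg]

lemma exp_half_cov_comm (hG : IsStationaryGaussianField P G C) (x y : ℝ) :
    Real.exp (C (y - x) / 2) = Real.exp (C (x - y) / 2) := by
  rw [← hG.cov_even (x - y), neg_sub]

lemma integral_fluct (hG : IsStationaryGaussianField P G C) (x : ℝ) :
    ∫ ω, fluct G C x ω ∂P = 0 := by
  have h := hG.integral_prod_fluct (insert 0 ∅) ![x]
  simp only [Finset.sum_powerset_insert, Finset.powerset_empty, Finset.sum_singleton,
    Finset.prod_insert, Finset.prod_empty, Finset.card_insert_of_notMem, Finset.card_empty,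
    Finset.notMem_empty, not_false_eq_true, Matrix.cons_val,
    sub_self, mul_one] at h
  rw [h, neg_mul, inv_mul_cancel₀ (Real.exp_pos _).ne', add_neg_cancel, mul_zero]

lemma integral_fluct_mul (hG : IsStationaryGaussianField P G C) (x y : ℝ) :
    ∫ ω, fluct G C x ω * fluct G C y ω ∂P = Real.exp (C 0) * (Real.exp (C (x - y)) - 1) := by
  have h := hG.integral_prod_fluct (insert 0 (insert 1 ∅)) ![x, y]
  simp only [Finset.sum_powerset_insert, Finset.powerset_empty, Finset.sum_singleton,
    Finset.prod_insert, Finset.prod_empty, Finset.card_insert_of_notMem, Finset.card_empty,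
    Finset.mem_insert, Finset.notMem_empty, zero_ne_one, or_false, not_false_eq_true,
    Matrix.cons_val, sub_self, mul_one] at h
  rw [h, hG.exp_half_cov_comm x y, exp_eq_exp_half_sq (C 0), exp_eq_exp_half_sq (C (x - y))]
  field_simp
  ring

lemma integral_fluct_mul_four (hG : IsStationaryGaussianField P G C) (x y z w : ℝ) :
    ∫ ω, fluct G C x ω * fluct G C y ω * (fluct G C z ω * fluct G C w ω) ∂P =
      Real.exp (C 0) ^ 2 * fourPoint (Real.exp (C (x - y)) - 1) (Real.exp (C (x - z)) - 1)
        (Real.exp (C (x - w)) - 1) (Real.exp (C (y - z)) - 1) (Real.exp (C (y - w)) - 1)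
        (Real.exp (C (z - w)) - 1) := by
  have h := hG.integral_prod_fluct (insert 0 (insert 1 (insert 2 (insert 3 ∅)))) ![x, y, z, w]
  simp only [Finset.sum_powerset_insert, Finset.powerset_empty, Finset.sum_singleton,
    Finset.prod_insert, Finset.prod_empty, Finset.card_insert_of_notMem, Finset.card_empty,
    Finset.mem_insert, Finset.notMem_empty, Fin.reduceEq, zero_ne_one, or_false,
    not_false_eq_true, Matrix.cons_val, sub_self, mul_one] at h
  simp only [hG.exp_half_cov_comm x, hG.exp_half_cov_comm y z, hG.exp_half_cov_comm y w,
    hG.exp_half_cov_comm z w] at h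
  simp only [mul_assoc] at h ⊢
  rw [h, fourPoint]
  simp only [exp_eq_exp_half_sq (C _)]
  field_simp
  ring

lemma covInv_eq (hG : IsStationaryGaussianField P G C) (x : ℝ) :
    covInv P G x = Real.exp (C 0) * (Real.exp (C x) - 1) := by
  have h_fluct : ∀ x ω, 1 / coeff G x ω - Real.exp (C 0 / 2) = fluct G C x ω := fun x ω => by
    rw [coeff, one_div, ← Real.exp_neg, fluct]
  have h_mean : ∀ x, ∫ ω, 1 / coeff G x ω ∂P = Real.exp (C 0 / 2) := fun x => by
    have := hG.integral_prod_exp_neg {0} fun _ : ℕ => x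
    simpa [coeff, ← Real.exp_neg] using this
  rw [covInv, covariance, h_mean, h_mean]
  simp only [h_fluct]
  rw [hG.integral_fluct_mul, sub_zero]

lemma limQ_eq (hG : IsStationaryGaussianField P G C) :
    limQ P G = Real.exp (C 0) * ∫ x, (Real.exp (C x) - 1) := by
  simp only [limQ, hG.covInv_eq, integral_const_mul]

lemma memLp_fluct (hG : IsStationaryGaussianField P G C) (x : ℝ) : MemLp (fluct G C x) 2 P := by
  have h_meas : AEMeasurable (fluct G C x) P := (hG.gaussian.aemeasurable x).neg.exp.sub_const _
  rw [memLp_two_iff_integrable_sq h_meas.aestronglyMeasurable]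
  simpa [sq] using hG.integrable_prod_fluct Finset.univ ![x, x]

lemma memLp_fluct_mul (hG : IsStationaryGaussianField P G C) (x y : ℝ) :
    MemLp (fun ω => fluct G C x ω * fluct G C y ω) 2 P := by
  refine (memLp_two_iff_integrable_sq
    ((hG.memLp_fluct x).aestronglyMeasurable.mul (hG.memLp_fluct y).aestronglyMeasurable)).2 ?_
  simpa [sq, Fin.prod_univ_four, mul_assoc] using hG.integrable_prod_fluct Finset.univ ![x, y, x, y]

lemma isStationaryField_fluct (hG : IsStationaryGaussianField P G C)
    (hG_cont : ∀ ω, Continuous fun x => G x ω) (hG_meas : ∀ x, Measurable (G x)) :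
    IsStationaryField P (fluct G C) (covInv P G) where
  continuous ω := (hG_cont ω).neg.rexp.sub continuous_const
  measurable x := (hG_meas x).neg.exp.sub_const _
  memLp := hG.memLp_fluct
  mean_zero := hG.integral_fluct
  integral_mul x y := by rw [hG.integral_fluct_mul, hG.covInv_eq]

lemma isMixingField_fluct (hG : IsStationaryGaussianField P G C)
    (hG_cont : ∀ ω, Continuous fun x => G x ω) (hG_meas : ∀ x, Measurable (G x)) {R : ℝ}
    (hR : ∀ z, |Real.exp (C z) - 1| ≤ R) :
    IsMixingField P (fluct G C) (covInv P G) ((1 + R) ^ 4) where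
  toIsStationaryField := hG.isStationaryField_fluct hG_cont hG_meas
  memLp_mul := hG.memLp_fluct_mul
  const_nonneg := by positivity
  four_point p q := by
    rw [hG.integral_fluct_mul_four, abs_mul, abs_of_nonneg (sq_nonneg _)]
    simp only [hG.covInv_eq, abs_mul, pairSum_const_mul, abs_of_pos (Real.exp_pos (C 0))]
    rw [mul_left_comm]
    refine mul_le_mul_of_nonneg_left ?_ (sq_nonneg _)
    exact abs_fourPoint_le (hR _) (hR _) (hR _) (hR _) (hR _) (hR _)

end IsStationaryGaussianField

end LogNormalFluctuation

section LimitingVariance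

open Filter

variable {Ω : Type*} [MeasurableSpace Ω] {P : Measure Ω} {G : ℝ → Ω → ℝ} {C : ℝ → ℝ} {A b : ℝ}

namespace IsStationaryGaussianField

lemma abs_covInv_le (hG : IsStationaryGaussianField P G C) (hb : 0 ≤ b)
    (hdecay : ∀ z, |C z| ≤ A * (1 + |z|) ^ (-b)) (z : ℝ) :
    |covInv P G z| ≤ Real.exp (C 0) * (A * Real.exp A) * (1 + |z|) ^ (-b) := by
  rw [hG.covInv_eq, abs_mul, abs_of_pos (Real.exp_pos _), mul_assoc]
  exact mul_le_mul_of_nonneg_left (decay_exp_sub_one hb hdecay z) (Real.exp_pos _).le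

/-- Writing `exp C - 1 = C + (exp C - 1 - C)`, the first part has nonnegative integral because it
is a covariance function, the second one is nonnegative and positive near the origin. -/
lemma integral_exp_cov_sub_one_pos (hG : IsStationaryGaussianField P G C)
    (hG_cont : ∀ ω, Continuous fun x => G x ω) (hG_meas : ∀ x, Measurable (G x)) (hb : 1 < b)
    (hb' : b < 2) (hdecay : ∀ z, |C z| ≤ A * (1 + |z|) ^ (-b)) (hC : 0 < C 0) :
    0 < ∫ z, (Real.exp (C z) - 1) := by
  have := hG.gaussian.isProbabilityMeasure
  have h_field := hG.isStationaryField hG_cont hG_meas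
  have hC_meas := h_field.measurable_cov
  have hC_int : Integrable C := integrable_of_decay hC_meas hb hdecay
  have h_exp_int : Integrable fun z => Real.exp (C z) - 1 :=
    integrable_of_decay (by fun_prop) hb (decay_exp_sub_one (by linarith) hdecay)
  have h_convex_int : Integrable fun z => Real.exp (C z) - 1 - C z := h_exp_int.sub hC_int
  have h_split : ∫ z, (Real.exp (C z) - 1) = (∫ z, C z) + ∫ z, (Real.exp (C z) - 1 - C z) := by
    rw [← integral_add hC_int h_convex_int]
    simp only [add_sub_cancel]
  have h_convex_pos : 0 < ∫ z, (Real.exp (C z) - 1 - C z) := by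
    rw [integral_pos_iff_support_of_nonneg (fun z => by
      simp only [Pi.zero_apply]; linarith [Real.add_one_le_exp (C z)]) h_convex_int]
    have h_near := (hG.tendsto_cov_zero (.of_forall hG_cont)).eventually (lt_mem_nhds hC)
    refine Measure.measure_pos_of_mem_nhds volume (x := 0) (mem_of_superset h_near fun z hz => ?_)
    have := Real.add_one_lt_exp (ne_of_gt hz)
    simp only [Function.mem_support]
    linarith
  linarith [h_field.integral_cov_nonneg hb hb' hdecay]

end IsStationaryGaussianField

end LimitingVariance

section BoundaryValueProblem

variable {a f g u v : ℝ → ℝ} {ε p q x : ℝ}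

lemma hasDerivAt_derivWithin_Icc (hu : ContDiffOn ℝ 1 u (Icc p q)) (hx : x ∈ Ioo p q) :
    HasDerivAt u (derivWithin u (Icc p q) x) x :=
  (hu.differentiableOn one_ne_zero x (Ioo_subset_Icc_self hx)).hasDerivWithinAt.hasDerivAt
    (Icc_mem_nhds hx.1 hx.2)

lemma integral_derivWithin_Icc (hpq : p < q) (hu : ContDiffOn ℝ 1 u (Icc p q))
    (hx : x ∈ Icc p q) : ∫ t in p..x, derivWithin u (Icc p q) t = u x - u p := by
  have h_sub : Icc p x ⊆ Icc p q := Icc_subset_Icc le_rfl hx.2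
  have h_cont : ContinuousOn (derivWithin u (Icc p q)) (Icc p q) :=
    hu.continuousOn_derivWithin (uniqueDiffOn_Icc hpq) le_rfl
  exact intervalIntegral.integral_eq_sub_of_hasDerivAt_of_le hx.1 (hu.continuousOn.mono h_sub)
    (fun t ht => hasDerivAt_derivWithin_Icc hu ⟨ht.1, ht.2.trans_le hx.2⟩)
    ((h_cont.mono h_sub).intervalIntegrable_of_Icc hx.1)

lemma integrable_unitVolume (hf : ContinuousOn f (Icc 0 1)) : Integrable f unitVolume :=
  hf.integrableOn_Icc

lemma continuous_inv_comp_div (ha : Continuous a) (ha_pos : ∀ x, 0 < a x) (ε : ℝ) :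
    Continuous fun x => (a (x / ε))⁻¹ :=
  (ha.comp (continuous_id.div_const ε)).inv₀ fun x => (ha_pos (x / ε)).ne'

lemma integral_inv_comp_div_pos (ha : Continuous a) (ha_pos : ∀ x, 0 < a x) (ε : ℝ) :
    0 < ∫ x, (a (x / ε))⁻¹ ∂unitVolume := by
  rw [← intervalIntegral_eq_integral_unitVolume]
  exact intervalIntegral.intervalIntegral_pos_of_pos
    ((continuous_inv_comp_div ha ha_pos ε).intervalIntegrable _ _)
    (fun x => inv_pos.2 (ha_pos (x / ε))) zero_lt_one

namespace IsSolution

lemma exists_derivWithin_eq (ha : Continuous a) (ha_pos : ∀ x, 0 < a x)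
    (hf : ContDiffOn ℝ 1 f (Icc 0 1)) (hu : IsSolution a ε f u) :
    ∃ c, ∀ x ∈ Icc (0 : ℝ) 1, derivWithin u (Icc 0 1) x = (f x - c) * (a (x / ε))⁻¹ := by
  have hu_cont : ContinuousOn (derivWithin u (Icc 0 1)) (Icc 0 1) :=
    hu.contDiffOn.continuousOn_derivWithin (uniqueDiffOn_Icc zero_lt_one) le_rfl
  let flux : ℝ → ℝ := fun x => a (x / ε) * derivWithin u (Icc 0 1) x
  have h_cont : ContinuousOn (fun x => flux x - f x) (Icc 0 1) :=
    ((ha.comp (continuous_id.div_const ε)).continuousOn.mul hu_cont).sub hf.continuousOn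
  have h_deriv : ∀ x ∈ Ioo (0 : ℝ) 1, HasDerivAt (fun x => flux x - f x) 0 x := fun x hx => by
    have h := (hu.equation x hx).sub (hasDerivAt_derivWithin_Icc hf hx)
    rwa [sub_self] at h
  have h_const : ∀ x ∈ Icc (0 : ℝ) 1, flux x - f x = flux 0 - f 0 := fun x hx => by
    have h_ftc := intervalIntegral.integral_eq_sub_of_hasDerivAt_of_le hx.1
      (h_cont.mono (Icc_subset_Icc le_rfl hx.2))
      (fun t ht => h_deriv t ⟨ht.1, ht.2.trans_le hx.2⟩) (intervalIntegrable_const (c := 0))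
    rw [intervalIntegral.integral_zero] at h_ftc
    linarith
  refine ⟨f 0 - flux 0, fun x hx => ?_⟩
  rw [eq_mul_inv_iff_mul_eq₀ (ha_pos _).ne', mul_comm]
  linarith [h_const x hx]

lemma derivWithin_eq (ha : Continuous a) (ha_pos : ∀ x, 0 < a x)
    (hf : ContDiffOn ℝ 1 f (Icc 0 1)) (hu : IsSolution a ε f u) (hx : x ∈ Icc (0 : ℝ) 1) :
    derivWithin u (Icc 0 1) x =
      (f x - weightedMean unitVolume (fun y => (a (y / ε))⁻¹) f) * (a (x / ε))⁻¹ := by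
  obtain ⟨c, hc⟩ := hu.exists_derivWithin_eq ha ha_pos hf
  have hw := (continuous_inv_comp_div ha ha_pos ε).continuousOn (s := Icc 0 1)
  have h_zero : ∫ x, (f x - c) * (a (x / ε))⁻¹ ∂unitVolume = 0 := by
    rw [← integral_unitVolume_congr hc, ← intervalIntegral_eq_integral_unitVolume,
      integral_derivWithin_Icc zero_lt_one hu.contDiffOn (right_mem_Icc.2 zero_le_one), hu.left,
      hu.right, sub_zero]
  rw [hc x hx, eq_weightedMean_of_integral_eq_zero (integrable_unitVolume hw)
    (integral_inv_comp_div_pos ha ha_pos ε).ne'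
    (integrable_unitVolume (hf.continuousOn.mul hw)) h_zero]

lemma eqOn (ha : Continuous a) (ha_pos : ∀ x, 0 < a x) (hf : ContDiffOn ℝ 1 f (Icc 0 1))
    (hu : IsSolution a ε f u) (hv : IsSolution a ε f v) : EqOn u v (Icc 0 1) := by
  intro x hx
  calc u x = ∫ t in (0 : ℝ)..x, derivWithin u (Icc 0 1) t := by
        rw [integral_derivWithin_Icc zero_lt_one hu.contDiffOn hx, hu.left, sub_zero]
    _ = ∫ t in (0 : ℝ)..x, derivWithin v (Icc 0 1) t := by
        refine intervalIntegral.integral_congr fun t ht => ?_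
        rw [uIcc_of_le hx.1] at ht
        have ht' : t ∈ Icc (0 : ℝ) 1 := ⟨ht.1, ht.2.trans hx.2⟩
        rw [hu.derivWithin_eq ha ha_pos hf ht', hv.derivWithin_eq ha ha_pos hf ht']
    _ = v x := by
        rw [integral_derivWithin_Icc zero_lt_one hv.contDiffOn hx, hv.left, sub_zero]

/-- A primitive of `w (f - m)`, with `w = 1 / a(· / ε)` and `m` the `w`-mean of `f`. As `f` is
only controlled on the unit interval, it is first extended by constants. -/
lemma exists_isSolution (ha : Continuous a) (ha_pos : ∀ x, 0 < a x)
    (hf : ContDiffOn ℝ 1 f (Icc 0 1)) (ε : ℝ) : ∃ u, IsSolution a ε f u := by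
  have hw := continuous_inv_comp_div ha ha_pos ε
  let c := weightedMean unitVolume (fun y => (a (y / ε))⁻¹) f
  let F : ℝ → ℝ := IccExtend zero_le_one ((Icc (0 : ℝ) 1).domRestrict f)
  have hF_eq : ∀ x ∈ Icc (0 : ℝ) 1, F x = f x := fun x hx => IccExtend_of_mem _ _ hx
  have h_cont : Continuous fun x => (F x - c) * (a (x / ε))⁻¹ :=
    (hf.continuousOn.domRestrict.Icc_extend'.sub continuous_const).mul hw
  let u : ℝ → ℝ := fun x => ∫ t in (0 : ℝ)..x, (F t - c) * (a (t / ε))⁻¹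
  have hu_deriv : ∀ x, HasDerivAt u ((F x - c) * (a (x / ε))⁻¹) x := fun x =>
    (h_cont.integral_hasStrictDerivAt 0 x).hasDerivAt
  refine ⟨u, ContDiff.contDiffOn ?_, fun x hx => ?_, intervalIntegral.integral_same, ?_⟩
  · refine contDiff_one_iff_deriv.2 ⟨fun x => (hu_deriv x).differentiableAt, ?_⟩
    rwa [funext fun x => (hu_deriv x).deriv]
  · refine ((hasDerivAt_derivWithin_Icc hf hx).sub_const c).congr_of_eventuallyEq ?_
    filter_upwards [Icc_mem_nhds hx.1 hx.2] with y hy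
    rw [(hu_deriv y).hasDerivWithinAt.derivWithin (uniqueDiffOn_Icc zero_lt_one y hy), hF_eq y hy,
      mul_comm, inv_mul_cancel_right₀ (ha_pos _).ne']
  · calc u 1 = ∫ x, (f x - c) * (a (x / ε))⁻¹ ∂unitVolume := by
          rw [← intervalIntegral_eq_integral_unitVolume]
          refine intervalIntegral.integral_congr fun x hx => ?_
          rw [uIcc_of_le zero_le_one] at hx
          simp only [hF_eq x hx]
      _ = 0 := integral_sub_weightedMean_mul_weight (integrable_unitVolume hw.continuousOn)
          (integral_inv_comp_div_pos ha ha_pos ε).ne'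
          (integrable_unitVolume (hf.continuousOn.mul hw.continuousOn))

lemma observable_eq (ha : Continuous a) (ha_pos : ∀ x, 0 < a x)
    (hf : ContDiffOn ℝ 1 f (Icc 0 1)) (hg : ContinuousOn g (Icc 0 1))
    (hu : IsSolution a ε f u) :
    observable u g = weightedCov unitVolume (fun x => (a (x / ε))⁻¹) f g := by
  have hw := (continuous_inv_comp_div ha ha_pos ε).continuousOn (s := Icc 0 1)
  rw [observable, intervalIntegral_eq_integral_unitVolume,
    ← integral_sub_weightedMean_mul_mul_weight (integrable_unitVolume (hg.mul hw))
      (integrable_unitVolume ((hf.continuousOn.mul hg).mul hw))]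
  exact integral_unitVolume_congr fun x hx => by
    simp only [hu.derivWithin_eq ha ha_pos hf hx, mul_right_comm]

lemma observable_comm (ha : Continuous a) (ha_pos : ∀ x, 0 < a x)
    (hf : ContDiffOn ℝ 1 f (Icc 0 1)) (hg : ContDiffOn ℝ 1 g (Icc 0 1))
    (hu : IsSolution a ε f u) (hv : IsSolution a ε g v) :
    observable u g = observable v f := by
  rw [hu.observable_eq ha ha_pos hf hg.continuousOn, hv.observable_eq ha ha_pos hg hf.continuousOn,
    weightedCov_comm]

end IsSolution

end BoundaryValueProblem

section CenteredTestFunctions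

variable {f g w : ℝ → ℝ} {x y : ℝ}

lemma bddAbove_range_abs_Icc (hf : ContinuousOn f (Icc 0 1)) :
    BddAbove (range fun x : Icc (0 : ℝ) 1 => |f x|) := by
  have := (isCompact_Icc.image_of_continuousOn hf.abs).bddAbove
  rwa [image_eq_range] at this

lemma abs_le_normC1 (hf : ContinuousOn f (Icc 0 1)) (hx : x ∈ Icc (0 : ℝ) 1) :
    |f x| ≤ normC1 f :=
  le_add_of_le_of_nonneg (le_ciSup (bddAbove_range_abs_Icc hf) ⟨x, hx⟩)
    (Real.iSup_nonneg fun _ => abs_nonneg _)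

lemma abs_derivWithin_le_normC1 (hf : ContDiffOn ℝ 1 f (Icc 0 1)) (hx : x ∈ Icc (0 : ℝ) 1) :
    |derivWithin f (Icc 0 1) x| ≤ normC1 f :=
  le_add_of_nonneg_of_le (Real.iSup_nonneg fun _ => abs_nonneg _)
    (le_ciSup (bddAbove_range_abs_Icc
      (hf.continuousOn_derivWithin (uniqueDiffOn_Icc zero_lt_one) le_rfl)) ⟨x, hx⟩)

lemma abs_sub_le_normC1_mul (hf : ContDiffOn ℝ 1 f (Icc 0 1)) (hx : x ∈ Icc (0 : ℝ) 1)
    (hy : y ∈ Icc (0 : ℝ) 1) : |f x - f y| ≤ normC1 f * |x - y| :=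
  (convex_Icc (0 : ℝ) 1).norm_image_sub_le_of_norm_derivWithin_le
    (hf.differentiableOn one_ne_zero) (fun _ hz => abs_derivWithin_le_normC1 hf hz) hy hx

/-- The function `f - ∫₀¹ f` on the unit interval, extended by zero. -/
noncomputable def centered (f : ℝ → ℝ) : ℝ → ℝ :=
  (Icc 0 1).indicator fun x => f x - ∫ y in (0 : ℝ)..1, f y

lemma centered_of_mem (hx : x ∈ Icc (0 : ℝ) 1) :
    centered f x = f x - ∫ y in (0 : ℝ)..1, f y :=
  indicator_of_mem hx _

lemma isTestFunction_centered (hf : ContDiffOn ℝ 1 f (Icc 0 1)) :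
    IsTestFunction (centered f) (2 * normC1 f) where
  eq_zero x hx := indicator_of_notMem hx _
  abs_le_of_mem x hx := by
    have h_mean : |∫ y in (0 : ℝ)..1, f y| ≤ normC1 f := by
      simpa using intervalIntegral.norm_integral_le_of_norm_le_const (a := (0 : ℝ)) (b := 1)
        (f := f) (C := normC1 f) fun y hy => abs_le_normC1 hf.continuousOn
          (Ioc_subset_Icc_self (by rwa [uIoc_of_le zero_le_one] at hy))
    rw [centered_of_mem hx]
    linarith [abs_sub (f x) (∫ y in (0 : ℝ)..1, f y), abs_le_normC1 hf.continuousOn hx]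
  abs_sub_le x hx y hy := by
    have h_nonneg : 0 ≤ normC1 f * |x - y| := (abs_nonneg _).trans (abs_sub_le_normC1_mul hf hx hy)
    rw [centered_of_mem hx, centered_of_mem hy, sub_sub_sub_cancel_right]
    linarith [abs_sub_le_normC1_mul hf hx hy]

lemma integral_centered (hf : ContinuousOn f (Icc 0 1)) :
    ∫ x, centered f x ∂unitVolume = 0 := by
  rw [integral_unitVolume_congr fun x hx => centered_of_mem hx,
    integral_sub (integrable_unitVolume hf) (integrable_const _),
    intervalIntegral_eq_integral_unitVolume]
  simp

lemma integral_centered_mul_sq (f g : ℝ → ℝ) :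
    ∫ x, (centered f x * centered g x) ^ 2 = ∫ x in (0 : ℝ)..1,
      (f x - ∫ y in (0 : ℝ)..1, f y) ^ 2 * (g x - ∫ y in (0 : ℝ)..1, g y) ^ 2 := by
  rw [intervalIntegral_eq_integral_unitVolume, ← setIntegral_eq_integral_of_forall_compl_eq_zero
    (s := Icc (0 : ℝ) 1) fun x hx => by simp [centered, hx]]
  exact integral_unitVolume_congr fun x hx => by simp only [centered_of_mem hx, mul_pow]

lemma weightedCov_centered (hw : ContinuousOn w (Icc 0 1)) (hw_ne : ∫ x, w x ∂unitVolume ≠ 0)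
    (hf : ContinuousOn f (Icc 0 1)) (hg : ContinuousOn g (Icc 0 1)) :
    weightedCov unitVolume w (centered f) (centered g) = weightedCov unitVolume w f g := by
  rw [← weightedCov_sub_const (integrable_unitVolume hw) hw_ne (integrable_unitVolume (hf.mul hw))
    (integrable_unitVolume (hg.mul hw)) (integrable_unitVolume ((hf.mul hg).mul hw))
    (∫ y in (0 : ℝ)..1, f y) (∫ y in (0 : ℝ)..1, g y), weightedCov, weightedCov]
  congr 1
  · exact integral_unitVolume_congr fun x hx => by simp only [centered_of_mem hx]
  · congr 2 <;> exact integral_unitVolume_congr fun x hx => by simp only [centered_of_mem hx]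

end CenteredTestFunctions

section ScaledVariance

variable {Ω : Type*} {G : ℝ → Ω → ℝ} {C : ℝ → ℝ} {A b : ℝ}

lemma coeff_pos (G : ℝ → Ω → ℝ) (x : ℝ) (ω : Ω) : 0 < coeff G x ω := Real.exp_pos _

lemma continuous_coeff {ω : Ω} (hω : Continuous fun x => G x ω) :
    Continuous fun x => coeff G x ω := hω.rexp

lemma inv_coeff_eq_add_fluct (G : ℝ → Ω → ℝ) (C : ℝ → ℝ) (x : ℝ) (ω : Ω) :
    (coeff G x ω)⁻¹ = Real.exp (C 0 / 2) + fluct G C x ω := by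
  rw [coeff, ← Real.exp_neg, fluct, add_sub_cancel]

variable [MeasurableSpace Ω] {P : Measure Ω}

lemma ae_exists_isSolution_and_eqOn (hG_cont : ∀ᵐ ω ∂P, Continuous fun x => G x ω) :
    ∀ᵐ ω ∂P, ∀ ε : ℝ, 0 < ε → ∀ f : ℝ → ℝ, ContDiffOn ℝ 1 f (Icc 0 1) →
      (∃ u, IsSolution (fun x => coeff G x ω) ε f u) ∧
      ∀ u₁ u₂, IsSolution (fun x => coeff G x ω) ε f u₁ →
        IsSolution (fun x => coeff G x ω) ε f u₂ → EqOn u₁ u₂ (Icc 0 1) := by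
  filter_upwards [hG_cont] with ω hω ε _ f hf
  have ha := continuous_coeff hω
  have ha_pos := (coeff_pos G · ω)
  exact ⟨IsSolution.exists_isSolution ha ha_pos hf ε, fun _ _ h₁ h₂ => h₁.eqOn ha ha_pos hf h₂⟩

lemma ae_observable_comm {f g : ℝ → ℝ} {ε : ℝ} {u v : Ω → ℝ → ℝ}
    (hG_cont : ∀ᵐ ω ∂P, Continuous fun x => G x ω) (hf : ContDiffOn ℝ 1 f (Icc 0 1))
    (hg : ContDiffOn ℝ 1 g (Icc 0 1)) (hu : ∀ᵐ ω ∂P, IsSolution (fun x => coeff G x ω) ε f (u ω))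
    (hv : ∀ᵐ ω ∂P, IsSolution (fun x => coeff G x ω) ε g (v ω)) :
    ∀ᵐ ω ∂P, observable (u ω) g = observable (v ω) f := by
  filter_upwards [hG_cont, hu, hv] with ω hω hu hv
  exact hu.observable_comm (continuous_coeff hω) (coeff_pos G · ω) hf hg hv

namespace IsStationaryGaussianField

lemma exists_modification (hG : IsStationaryGaussianField P G C)
    (hG_cont : ∀ᵐ ω ∂P, Continuous fun x => G x ω) :
    ∃ G' : ℝ → Ω → ℝ, IsStationaryGaussianField P G' C ∧ (∀ ω, Continuous fun x => G' x ω) ∧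
      (∀ x, Measurable (G' x)) ∧ ∀ᵐ ω ∂P, ∀ x, G' x ω = G x ω := by
  obtain ⟨G', hG'_cont, hG'_meas, hG'_eq⟩ :=
    exists_continuous_measurable_modification hG.gaussian.aemeasurable hG_cont
  exact ⟨G', hG.congr fun x => hG'_eq.mono fun ω hω => (hω x).symm, hG'_cont, hG'_meas, hG'_eq⟩

lemma integrable_exp_cov_sub_one (hG : IsStationaryGaussianField P G C)
    (hG_cont : ∀ᵐ ω ∂P, Continuous fun x => G x ω) (hb : 1 < b)
    (hdecay : ∀ z, |C z| ≤ A * (1 + |z|) ^ (-b)) : Integrable fun z => Real.exp (C z) - 1 := by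
  have := hG.gaussian.isProbabilityMeasure
  obtain ⟨G', hG', hG'_cont, hG'_meas, -⟩ := hG.exists_modification hG_cont
  have hC_meas := (hG'.isStationaryField hG'_cont hG'_meas).measurable_cov
  exact integrable_of_decay (by fun_prop) hb (decay_exp_sub_one (by linarith) hdecay)

lemma limQ_pos (hG : IsStationaryGaussianField P G C)
    (hG_cont : ∀ᵐ ω ∂P, Continuous fun x => G x ω) (hG_ne : ¬ ∀ᵐ ω ∂P, ∀ x, G x ω = 0)
    (hb : 1 < b) (hb' : b < 2) (hdecay : ∀ z, |C z| ≤ A * (1 + |z|) ^ (-b)) : 0 < limQ P G := by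
  obtain ⟨G', hG', hG'_cont, hG'_meas, -⟩ := hG.exists_modification hG_cont
  rw [hG.limQ_eq]
  exact mul_pos (Real.exp_pos _) (hG'.integral_exp_cov_sub_one_pos hG'_cont hG'_meas hb hb' hdecay
    (hG.cov_zero_pos hG_cont hG_ne))

lemma exists_abs_variance_weightedCov_inv_coeff_sub_le (hG : IsStationaryGaussianField P G C)
    (hG_cont : ∀ ω, Continuous fun x => G x ω) (hG_meas : ∀ x, Measurable (G x)) (hb : 1 < b)
    (hb' : b ≤ 3 / 2) (hdecay : ∀ z, |C z| ≤ A * (1 + |z|) ^ (-b)) :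
    ∃ K, ∀ f g : ℝ → ℝ, ContDiffOn ℝ 1 f (Icc 0 1) → ContDiffOn ℝ 1 g (Icc 0 1) →
      ∀ ε : ℝ, 0 < ε →
        MemLp (fun ω => weightedCov unitVolume (fun x => (coeff G (x / ε) ω)⁻¹) f g) 2 P ∧
        |ε⁻¹ * Var[fun ω => weightedCov unitVolume (fun x => (coeff G (x / ε) ω)⁻¹) f g; P] -
          sigmaSq P G f g| ≤ K * normC1 f ^ 2 * normC1 g ^ 2 * ε ^ (b - 1) := by
  have := hG.gaussian.isProbabilityMeasure
  have hb_nonneg : 0 ≤ b := by linarith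
  have h_mixing := hG.isMixingField_fluct hG_cont hG_meas
    (decay_le_const hb_nonneg (decay_exp_sub_one hb_nonneg hdecay))
  obtain ⟨D, hD⟩ := h_mixing.exists_abs_variance_weightedCov_sub_le
    (m := Real.exp (C 0 / 2))
    (fun x ω => by rw [← inv_coeff_eq_add_fluct]; exact inv_pos.2 (coeff_pos G x ω))
    (Real.exp_pos _) hb hb' (hG.abs_covInv_le hb_nonneg hdecay)
  refine ⟨16 * D, fun f g hf hg ε hε => ?_⟩
  have h_centered : ∀ ω, weightedCov unitVolume
      (fun x => Real.exp (C 0 / 2) + fluct G C (x / ε) ω) (centered f) (centered g) =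
      weightedCov unitVolume (fun x => (coeff G (x / ε) ω)⁻¹) f g := fun ω => by
    have ha := continuous_coeff (hG_cont ω)
    simp only [← inv_coeff_eq_add_fluct]
    exact weightedCov_centered (continuous_inv_comp_div ha (coeff_pos G · ω) ε).continuousOn
      (integral_inv_comp_div_pos ha (coeff_pos G · ω) ε).ne' hf.continuousOn hg.continuousOn
  obtain ⟨h_mem, h_le⟩ := hD (centered f) (centered g) (2 * normC1 f) (2 * normC1 g) ε
    (isTestFunction_centered hf) (isTestFunction_centered hg)
    (integral_centered hf.continuousOn) (integral_centered hg.continuousOn) hε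
  simp only [h_centered, integral_centered_mul_sq] at h_mem h_le
  exact ⟨h_mem, h_le.trans_eq (by ring)⟩

lemma exists_abs_sigmaEps_sq_sub_le (hG : IsStationaryGaussianField P G C)
    (hG_cont : ∀ᵐ ω ∂P, Continuous fun x => G x ω) (hb : 1 < b) (hb' : b ≤ 3 / 2)
    (hdecay : ∀ z, |C z| ≤ A * (1 + |z|) ^ (-b)) :
    ∃ K, ∀ f g : ℝ → ℝ, ContDiffOn ℝ 1 f (Icc 0 1) → ContDiffOn ℝ 1 g (Icc 0 1) →
      ∀ ε : ℝ, 0 < ε → ∀ u : Ω → ℝ → ℝ,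
        (∀ᵐ ω ∂P, IsSolution (fun x => coeff G x ω) ε f (u ω)) →
        MemLp (fun ω => observable (u ω) g) 2 P ∧
        |sigmaEps P ε (fun ω => observable (u ω) g) ^ 2 - sigmaSq P G f g| ≤
          K * normC1 f ^ 2 * normC1 g ^ 2 * ε ^ (b - 1) := by
  obtain ⟨G', hG', hG'_cont, hG'_meas, hG'_eq⟩ := hG.exists_modification hG_cont
  obtain ⟨K, hK⟩ := hG'.exists_abs_variance_weightedCov_inv_coeff_sub_le hG'_cont hG'_meas hb hb'
    hdecay
  refine ⟨K, fun f g hf hg ε hε u hu => ?_⟩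
  obtain ⟨h_mem, h_le⟩ := hK f g hf hg ε hε
  have h_obs : (fun ω => observable (u ω) g) =ᵐ[P]
      fun ω => weightedCov unitVolume (fun x => (coeff G' (x / ε) ω)⁻¹) f g := by
    filter_upwards [hu, hG'_eq] with ω hu hω
    have h_coeff : (fun x => coeff G x ω) = fun x => coeff G' x ω :=
      funext fun x => by rw [coeff, coeff, hω]
    rw [h_coeff] at hu
    exact hu.observable_eq (continuous_coeff (hG'_cont ω)) (coeff_pos G' · ω) hf hg.continuousOn
  have h_sigmaSq : sigmaSq P G' f g = sigmaSq P G f g := by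
    rw [sigmaSq, sigmaSq, hG.limQ_eq, hG'.limQ_eq]
  rw [memLp_congr_ae h_obs, sigmaEps,
    Real.sq_sqrt (mul_nonneg (inv_nonneg.2 hε.le) (variance_nonneg _ _)), variance_congr h_obs,
    ← h_sigmaSq]
  exact ⟨h_mem, h_le⟩

end IsStationaryGaussianField

end ScaledVariance

end LogNormalHomogenization

theorem mainTheorem3 {Ω : Type*} [MeasurableSpace Ω] (P : Measure Ω) [IsProbabilityMeasure P]
    (G : ℝ → Ω → ℝ) (C : ℝ → ℝ) (hG : IsStationaryGaussianField P G C)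
    (hcont : ∀ᵐ ω ∂P, Continuous fun x => G x ω)
    (β : ℝ) (hβ : 1 < β) (hdecay : ∃ A : ℝ, ∀ x, |C x| ≤ A * (1 + |x|) ^ (-β))
    (hne : ¬ ∀ᵐ ω ∂P, ∀ x, G x ω = 0) :
    -- almost sure well-posedness of the boundary value problem
    (∀ᵐ ω ∂P, ∀ ε : ℝ, 0 < ε → ∀ f : ℝ → ℝ, ContDiffOn ℝ 1 f (Icc 0 1) →
      (∃ u, IsSolution (fun x => coeff G x ω) ε f u) ∧
      ∀ u₁ u₂, IsSolution (fun x => coeff G x ω) ε f u₁ →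
        IsSolution (fun x => coeff G x ω) ε f u₂ → EqOn u₁ u₂ (Icc 0 1)) ∧
    -- the constant `𝒬`
    Integrable (covInv P G) ∧
    Integrable (fun x => Real.exp (C x) - 1) ∧
    limQ P G = Real.exp (C 0) * ∫ x, (Real.exp (C x) - 1) ∧
    0 < limQ P G ∧
    -- convergence of the rescaled variance
    ∃ K : ℝ, ∀ f g : ℝ → ℝ, ContDiffOn ℝ 1 f (Icc 0 1) → ContDiffOn ℝ 1 g (Icc 0 1) →
      ∀ ε : ℝ, 0 < ε → ∀ u v : Ω → ℝ → ℝ,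
        (∀ᵐ ω ∂P, IsSolution (fun x => coeff G x ω) ε f (u ω)) →
        (∀ᵐ ω ∂P, IsSolution (fun x => coeff G x ω) ε g (v ω)) →
        (∀ᵐ ω ∂P, observable (u ω) g = observable (v ω) f) ∧
        MemLp (fun ω => observable (u ω) g) 2 P ∧
        |sigmaEps P ε (fun ω => observable (u ω) g) ^ 2 - sigmaSq P G f g| ≤
          K * normC1 f ^ 2 * normC1 g ^ 2 * ε ^ min (1 / 2) (β - 1) := by
  obtain ⟨A, hA⟩ := hdecay
  have hb : 1 < min β (3 / 2) := lt_min hβ (by norm_num)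
  have hb' : min β (3 / 2) ≤ 3 / 2 := min_le_right _ _
  have hA' := decay_mono (min_le_left β (3 / 2)) hA
  have h_int := hG.integrable_exp_cov_sub_one hcont hβ hA
  refine ⟨ae_exists_isSolution_and_eqOn hcont, ?_, h_int, hG.limQ_eq,
    hG.limQ_pos hcont hne hb (by linarith) hA', ?_⟩
  · simpa only [funext hG.covInv_eq] using h_int.const_mul (Real.exp (C 0))
  · have h_exponent : min (1 / 2) (β - 1) = min β (3 / 2) - 1 := by
      rw [← min_sub_sub_right, min_comm]
      norm_num
    obtain ⟨K, hK⟩ := hG.exists_abs_sigmaEps_sq_sub_le hcont hb hb' hA'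
    refine ⟨K, fun f g hf hg ε hε u v hu hv => ⟨ae_observable_comm hcont hf hg hu hv, ?_⟩⟩
    rw [h_exponent]
    exact hK f g hf hg ε hε u hu
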